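/- For $\ell\ge 1$ let $$S(\overline{2},\{1\}_{2\ell-1},1)=2^{2\ell+1}\sum_{\substack{n_1>n_2>\cdots>n_{2\ell+1}>0\\ n_1,n_3,\ldots,n_{2\ell+1}\text{ even}\\ n_2,n_4,\ldots,n_{2\ell}\text{ odd}}}\frac{(-1)^{n_1/2}}{n_1^2\,n_2\cdots n_{2\ell+1}},\qquad \zeta(\overline{2\ell+1},1)=\sum_{n>m>0}\frac{(-1)^n}{n^{2\ell+1}m},$$ each series being the limit as $N\to\infty$ of its truncation to largest index $\le N$. Let $\zeta(s)=\sum_{n\ge1}n^{-s}$ $(s>1)$ and $\beta(s)=\sum_{n\ge1}(-1)^{n-1}(2n-1)^{-s}$ $(s>0)$. Then for every integer $\ell\ge1$ both nested series converge, and $$\begin{aligned} S(\overline{2},\{1\}_{2\ell-1},1)={}&2\zeta(\overline{2\ell+1},1)+2^{-1-2\ell}\zeta(2\ell+2)+\big(2^{1-2\ell}-4\big)\log(2)\,\zeta(2\ell+1)\\ &+\sum_{\substack{r+2k=2\ell-1\\ r,k\ge0}}4\log(2)\,\beta(r+1)\frac{(-1)^k}{(2k+1)!}\Big(\frac{\pi}{2}\Big)^{2k+1}\\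 &+\sum_{\substack{p+q=2\ell+2\\ p,q\ge2}}(-1)^p(1-2^{1-p})(3-2^{1-q})\zeta(p)\zeta(q)\\ &+\sum_{\substack{r+2k=2\ell\\ r,k\ge0}}2\beta(r+1)\frac{(-1)^{k+1}}{(2k+1)!}\Big(\frac{\pi}{2}\Big)^{2k+1} +\sum_{\substack{p+r=2\ell\\ p,r\ge0}}2(-1)^p\beta(r+1)\beta(p+1)\\ &+\sum_{\substack{p+r+2k=2\ell-1\\ p\ge1,\ r,k\ge0}}4(-1)^{p+k}\beta(r+1)(1-2^{-p})\zeta(p+1)\frac{1}{(2k+1)!}\Big(\frac{\pi}{2}\Big)^{2k+1}. \end{aligned}$$ In particular, $S(\overline{2},\{1\}_{2\ell-1},1)-2\zeta(\overline{2\ell+1},1)$ is a polynomial with rational coefficients in $\log 2$, $\pi$, the values $\zeta(2k+1)$ $(k\ge1)$ and the values $\beta(2p)$ $(p\ge1)$. -/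

import Mathlib

open Filter Topology

noncomputable section

namespace MixedValues

/-- The finite nested sum `∑_{N ≥ m₁ > m₂ > ⋯ > m_r > 0} w₁(m₁) w₂(m₂) ⋯ w_r(m_r)`
(the indices `1, …, r` of the text are `0, …, r - 1` in `Fin r`). -/
def nestedSum {r : ℕ} (w : Fin r → ℕ → ℝ) (N : ℕ) : ℝ :=
  ∑ m ∈ Fintype.piFinset (fun _ : Fin r => Finset.Icc 1 N) with ∀ i j, i < j → m j < m i,
    ∏ i, w i (m i)

/-- The summand factor `(1 + ε (-1)^m) σ^{(2m + 1 - ε)/4} / m^s` of an alternating multiple mixed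
value.  When the first factor is nonzero the exponent `(2m + 1 - ε)/4` is an exact integer:
it is `m/2` if `ε = 1` and `(m+1)/2` if `ε = -1`. -/
def mixedFactor (ε σ : ℤˣ) (s m : ℕ) : ℝ :=
  ((1 + (ε : ℤ) * (-1) ^ m : ℤ) : ℝ) * (((σ ^ ((2 * (m : ℤ) + 1 - (ε : ℤ)) / 4) : ℤˣ) : ℤ) : ℝ)
    / (m : ℝ) ^ s

/-- The truncation to `m₁ ≤ N` of the series for the alternating multiple mixed value
`M^{ε₁,…,ε_r}_{σ₁,…,σ_r}(s₁,…,s_r)`. -/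
def mixedTrunc {r : ℕ} (ε σ : Fin r → ℤˣ) (s : Fin r → ℕ) (N : ℕ) : ℝ :=
  nestedSum (fun i => mixedFactor (ε i) (σ i) (s i)) N

/-- The parities `…, od, ev, od, ev` (`ev = 1`, `od = -1`), ending in `ev`. -/
def parityS (r : ℕ) : Fin r → ℤˣ := fun i => (-1) ^ (i.rev : ℕ)

/-- Truncation to `m₁ ≤ N` of the series for the alternating multiple `S` value. -/
def multSTrunc {r : ℕ} (σ : Fin r → ℤˣ) (s : Fin r → ℕ) (N : ℕ) : ℝ :=
  mixedTrunc (parityS r) σ s N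

/-- The alternating multiple `S` value `S^{σ₁,…,σ_r}(s₁,…,s_r)`,
the sum of its nested series (as the limit of the truncations). -/
def multS {r : ℕ} (σ : Fin r → ℤˣ) (s : Fin r → ℕ) : ℝ :=
  limUnder atTop (multSTrunc σ s)

/-- Truncation to `m₁ ≤ N` of the series for the alternating multiple zeta value:
`∑_{N ≥ m₁ > ⋯ > m_r > 0} σ₁^{m₁} ⋯ σ_r^{m_r} / (m₁^{s₁} ⋯ m_r^{s_r})`. -/
def altZetaTrunc {r : ℕ} (σ : Fin r → ℤˣ) (s : Fin r → ℕ) (N : ℕ) : ℝ :=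
  nestedSum (fun i m => ((σ i : ℤ) : ℝ) ^ m / (m : ℝ) ^ s i) N

/-- The alternating multiple zeta value `ζ^{σ₁,…,σ_r}(s₁,…,s_r)`. -/
def altZeta {r : ℕ} (σ : Fin r → ℤˣ) (s : Fin r → ℕ) : ℝ :=
  limUnder atTop (altZetaTrunc σ s)

/-- Signs `-1, 1, …, 1`: only the first argument carries a bar. -/
def barFirst (n : ℕ) : Fin (n + 1) → ℤˣ := Fin.cons (-1) fun _ => 1

/-- Arguments `2, 1, …, 1` with `n` ones. -/
def twoOnes (n : ℕ) : Fin (n + 1) → ℕ := Fin.cons 2 fun _ => 1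

/-- The Riemann zeta value at a natural number, as a real number. -/
def zetaVal (s : ℕ) : ℝ := (riemannZeta s).re

/-- Truncated series of the Dirichlet beta function. -/
def betaTrunc (s N : ℕ) : ℝ :=
  ∑ n ∈ Finset.range N, (-1 : ℝ) ^ n / (2 * (n : ℝ) + 1) ^ s

/-- The Dirichlet beta value `β(s) = ∑_{n ≥ 1} (-1)^{n-1} / (2n-1)^s` at a natural number `s ≥ 1`
(for `s = 1` the series converges only conditionally, so it is taken as a limit). -/
def betaVal (s : ℕ) : ℝ := limUnder atTop (betaTrunc s)

theorem zetaVal_eq {s : ℕ} (hs : 1 < s) : (zetaVal s : ℂ) = riemannZeta s := by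
  have h : riemannZeta s = ((∑' n : ℕ, 1 / (n : ℝ) ^ s : ℝ) : ℂ) := by
    rw [zeta_nat_eq_tsum_of_gt_one hs]
    push_cast
    rfl
  rw [zetaVal, h, Complex.ofReal_re]

theorem betaTrunc_tendsto {s : ℕ} (hs : 1 ≤ s) :
    Tendsto (betaTrunc s) atTop (𝓝 (betaVal s)) := by
  have hanti : Antitone fun n : ℕ => 1 / (2 * (n : ℝ) + 1) ^ s := by
    intro a b hab
    have h : (a : ℝ) ≤ b := by exact_mod_cast hab
    dsimp only
    gcongr
  have hzero : Tendsto (fun n : ℕ => 1 / (2 * (n : ℝ) + 1) ^ s) atTop (𝓝 0) := by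
    have h1 : Tendsto (fun n : ℕ => 2 * (n : ℝ) + 1) atTop atTop :=
      tendsto_atTop_add_const_right _ _
        (tendsto_natCast_atTop_atTop.const_mul_atTop (by norm_num))
    have h2 := (tendsto_pow_atTop (α := ℝ) (n := s) (by omega)).comp h1
    refine h2.inv_tendsto_atTop.congr fun n => ?_
    simp
  obtain ⟨l, hl⟩ := hanti.tendsto_alternating_series_of_tendsto_zero hzero
  have : Tendsto (betaTrunc s) atTop (𝓝 l) := by
    refine hl.congr fun N => ?_
    simp [betaTrunc, div_eq_mul_inv]
  exact tendsto_nhds_limUnder ⟨l, this⟩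

end MixedValues

end

/-! Put y = tan(x/2) for 0 ≤ x ≤ π/2, so that dx = 2 dy/(1+y²) and dx/sin x = dy/y. Let F_0 = -y and
let F_{r+1} be the primitive of F_r with respect to x that vanishes at x = 0. The equation (1+y²)
dF_{r+1}/dy = 2 F_r, read on Taylor coefficients in y, produces up to sign exactly the nested sums
with unit exponents and alternating parities. Integrating F_{2ℓ+1} against dy/y over [0,1] supplies
the outer exponent 2, so S = (-1)^ℓ ∫ F_{2ℓ+1}/sin x dx over [0, π/2].

The same functions have a Fourier description: -tan(x/2) is formally 2 ∑ (-1)^n sin(nx), hence F_r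
is 2 ∑ (-1)^n times the r-fold primitive of sin(nx). Both descriptions are used at finite level N.
The truncated power series fails to be a tower of primitives only by a defect of size √N y^N, and
the truncated Fourier series differs from -tan(x/2) by an oscillating Dirichlet kernel; after
integration both errors are O(1/√N) (`tower_sub_one_le`, `tower_sub_le`), so S is the limit of the
Fourier side (`tendsto_multSTrunc_sub`).

The integral of the (2ℓ+1)-fold primitive against 1/sin x splits (`sinPrimIntegral_eq`) into ∫ (1 -
cos nx)/sin x, which is an explicit harmonic-type sum, and moments ∫ x^m/sin x. The moments follow
from 1/sin x = 2 ∑ sin((2j+1)x) and the Riemann-Lebesgue lemma (`neg_one_pow_mul_powIntegral`).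
Summed over n, the harmonic part gives twice the double zeta value plus single sums weighted by
alternating harmonic numbers; partial fractions and symmetry turn the latter into the convolutions ∑
(-1)^p η(p+1)η(q+1) and ∑ (-1)^p β(p+1)β(q+1) (`sum_etaVal_mul_etaVal`, `sum_betaVal_mul_betaVal`,
`hasSum_cosIntegral`).

The stated formula is then reached by bookkeeping with η(s) = (1-2^{1-s})ζ(s) and λ(s) =
(1-2^{-s})ζ(s), together with an expression of λ(2m+2) through odd beta values (`lamVal_even`). That
relation also shows that β(2m+1) is a rational multiple of π^{2m+1}, which gives the polynomial
shape. -/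

namespace MixedValues

/-! ### Nested sums as iterated single sums -/

open Finset in
/-- Peeling off the largest index of a nested sum. -/
theorem nestedSum_succ {r : ℕ} (w : Fin (r + 1) → ℕ → ℝ) (N : ℕ) :
    nestedSum w N =
      ∑ n ∈ Finset.Icc 1 N, w 0 n * nestedSum (fun i : Fin r => w i.succ) (n - 1) := by
  simp only [nestedSum, Finset.mul_sum]
  rw [Finset.sum_sigma']
  refine Finset.sum_bij' (fun m _ => (⟨m 0, Fin.tail m⟩ : Σ _ : ℕ, Fin r → ℕ))
    (fun x _ => Fin.cons x.1 x.2) ?_ ?_ ?_ ?_ ?_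
  · intro m hm
    simp only [mem_filter, Fintype.mem_piFinset, Finset.mem_Icc, mem_sigma] at hm ⊢
    refine ⟨hm.1 0, fun i => ⟨(hm.1 i.succ).1, ?_⟩, fun i j hij => hm.2 _ _ (by simpa using hij)⟩
    have := hm.2 0 i.succ (Fin.succ_pos i)
    simp only [Fin.tail]
    omega
  · rintro ⟨n, m⟩ hm
    simp only [mem_filter, Fintype.mem_piFinset, Finset.mem_Icc, mem_sigma] at hm ⊢
    obtain ⟨hn, hm, ho⟩ := hm
    refine ⟨fun i => ?_, fun i j hij => ?_⟩
    · refine Fin.cases ?_ (fun i => ?_) i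
      · simpa using hn
      · have := hm i
        simp only [Fin.cons_succ]
        omega
    · revert hij
      refine Fin.cases ?_ (fun j => ?_) j
      · intro h
        simp at h
      · refine Fin.cases ?_ (fun i => ?_) i
        · intro _
          have := hm j
          simp only [Fin.cons_succ, Fin.cons_zero]
          omega
        · intro h
          simpa using ho i j (by simpa using h)
  · intro m _
    exact Fin.cons_self_tail m
  · rintro ⟨n, m⟩ _
    simp
  · intro m _
    rw [Fin.prod_univ_succ]
    rfl

theorem nestedSum_zero (w : Fin 0 → ℕ → ℝ) (N : ℕ) : nestedSum w N = 1 := by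
  simp [nestedSum]

/-- Nested sums of depth `r` with all exponents one and alternating parities, ending in an even
index. -/
noncomputable def oneTrunc : ℕ → ℕ → ℝ
  | 0, _ => 1
  | r + 1, N => ∑ n ∈ Finset.Icc 1 N, (1 + (-1) ^ (r + n)) / (n : ℝ) * oneTrunc r (n - 1)

theorem oneTrunc_succ_succ (r N : ℕ) :
    oneTrunc (r + 1) (N + 1) = oneTrunc (r + 1) N +
      (1 + (-1) ^ (r + (N + 1))) / ((N + 1 : ℕ) : ℝ) * oneTrunc r N := by
  rw [oneTrunc, oneTrunc, Finset.sum_Icc_succ_top (by omega), Nat.add_sub_cancel]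

theorem mixedFactor_one_right (ε : ℤˣ) (s m : ℕ) :
    mixedFactor ε 1 s m = (1 + ((ε : ℤ) : ℝ) * (-1) ^ m) / (m : ℝ) ^ s := by
  simp [mixedFactor]

theorem parityS_zero (r : ℕ) : parityS (r + 1) 0 = (-1) ^ r := by
  simp [parityS]

theorem parityS_succ (r : ℕ) (i : Fin r) : parityS (r + 1) i.succ = parityS r i := by
  simp [parityS, Fin.rev_succ]

theorem mixedTrunc_ones (r N : ℕ) :
    mixedTrunc (parityS r) (fun _ => 1) (fun _ => 1) N = oneTrunc r N := by
  induction r generalizing N with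
  | zero => simp [mixedTrunc, nestedSum_zero, oneTrunc]
  | succ r ih =>
    rw [mixedTrunc, nestedSum_succ, oneTrunc]
    refine Finset.sum_congr rfl fun n _ => ?_
    rw [← ih (n - 1), mixedTrunc]
    simp only [parityS_succ]
    rw [mixedFactor_one_right, parityS_zero]
    push_cast
    rw [pow_one, pow_add]

theorem multSTrunc_eq (ℓ N : ℕ) :
    multSTrunc (barFirst (2 * ℓ)) (twoOnes (2 * ℓ)) N =
      ∑ n ∈ Finset.Icc 1 N, (-1) ^ (n / 2) * ((1 + (-1) ^ n) / (n : ℝ) ^ 2)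
        * oneTrunc (2 * ℓ) (n - 1) := by
  rw [multSTrunc, mixedTrunc, nestedSum_succ]
  refine Finset.sum_congr rfl fun n _ => ?_
  rw [← mixedTrunc_ones, mixedTrunc]
  simp only [parityS_succ, barFirst, twoOnes, Fin.cons_succ, Fin.cons_zero, parityS_zero]
  congr 1
  have h1 : ((-1 : ℤˣ) ^ (2 * ℓ)) = 1 := by rw [pow_mul]; simp
  rw [h1, mixedFactor]
  -- Both divisions round down, so this holds for odd n as well; those n carry the factor 1 + (-1)^n
  -- = 0 anyway.
  have h2 : ((2 * (n : ℤ) + 1 - ((1 : ℤˣ) : ℤ)) / 4) = ((n / 2 : ℕ) : ℤ) := by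
    simp only [Units.val_one]
    omega
  rw [h2, zpow_natCast]
  push_cast
  ring

theorem altZetaTrunc_eq (s N : ℕ) :
    altZetaTrunc ![-1, 1] ![s, 1] N =
      ∑ n ∈ Finset.Icc 1 N, (-1) ^ n / (n : ℝ) ^ s * ∑ m ∈ Finset.Icc 1 (n - 1), 1 / (m : ℝ) := by
  rw [altZetaTrunc, nestedSum_succ]
  refine Finset.sum_congr rfl fun n _ => ?_
  rw [nestedSum_succ]
  simp [nestedSum_zero]

/-! ### Growth of the nested sums -/

theorem oneTrunc_nonneg (r N : ℕ) : 0 ≤ oneTrunc r N := by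
  induction r generalizing N with
  | zero => simp [oneTrunc]
  | succ r ih =>
    rw [oneTrunc]
    refine Finset.sum_nonneg fun n _ => mul_nonneg (div_nonneg ?_ (by positivity)) (ih _)
    rcases neg_one_pow_eq_or ℝ (r + n) with h | h <;> rw [h] <;> norm_num

theorem sum_inv_sqrt_le (N : ℕ) :
    ∑ n ∈ Finset.Icc 1 N, 1 / √(n : ℝ) ≤ 2 * √(N : ℝ) := by
  induction N with
  | zero => simp
  | succ N ih =>
    rw [Finset.sum_Icc_succ_top (by omega)]
    have h1 : (0 : ℝ) < √((N + 1 : ℕ) : ℝ) := Real.sqrt_pos.2 (by positivity)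
    have h2 : √((N + 1 : ℕ) : ℝ) ^ 2 = N + 1 := by
      rw [Real.sq_sqrt (by positivity)]
      push_cast
      ring
    have h3 : √(N : ℝ) ^ 2 = N := Real.sq_sqrt (by positivity)
    have h4 : 1 / √((N + 1 : ℕ) : ℝ) ≤ 2 * √((N + 1 : ℕ) : ℝ) - 2 * √(N : ℝ) := by
      rw [div_le_iff₀ h1]
      nlinarith [sq_nonneg (√((N + 1 : ℕ) : ℝ) - √(N : ℝ))]
    linarith

theorem one_add_neg_one_pow_nonneg (k : ℕ) : (0 : ℝ) ≤ 1 + (-1) ^ k := by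
  rcases neg_one_pow_eq_or ℝ k with h | h <;> rw [h] <;> norm_num

theorem one_add_neg_one_pow_le (k : ℕ) : (1 : ℝ) + (-1) ^ k ≤ 2 := by
  rcases neg_one_pow_eq_or ℝ k with h | h <;> rw [h] <;> norm_num

/-- The true growth is a power of log N. The square root is a convenient majorant: integrating y^N
gains a factor 1/(N+1), so any bound o(N) makes the truncation defect vanish in the limit. -/
theorem oneTrunc_le (r N : ℕ) : oneTrunc r N ≤ 4 ^ r * √((N : ℝ) + 1) := by
  induction r generalizing N with
  | zero =>
    simp only [oneTrunc, pow_zero, one_mul]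
    rw [Real.one_le_sqrt]
    linarith [(Nat.cast_nonneg N : (0 : ℝ) ≤ N)]
  | succ r ih =>
    rw [oneTrunc]
    calc _ ≤ ∑ n ∈ Finset.Icc 1 N, 2 * 4 ^ r * (1 / √(n : ℝ)) := by
            refine Finset.sum_le_sum fun n hn => ?_
            rw [Finset.mem_Icc] at hn
            have hn0 : (0 : ℝ) < n := by exact_mod_cast hn.1
            have h := ih (n - 1)
            rw [Nat.cast_sub hn.1] at h
            simp only [Nat.cast_one, sub_add_cancel] at h
            have e : √(n : ℝ) / n = 1 / √(n : ℝ) := Real.sqrt_div_self'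
            calc _ ≤ 2 / (n : ℝ) * (4 ^ r * √(n : ℝ)) := by
                  gcongr
                  · exact oneTrunc_nonneg _ _
                  · exact one_add_neg_one_pow_le _
              _ = 2 * 4 ^ r * (√(n : ℝ) / n) := by ring
              _ = _ := by rw [e]
      _ = 2 * 4 ^ r * ∑ n ∈ Finset.Icc 1 N, 1 / √(n : ℝ) := by rw [Finset.mul_sum]
      _ ≤ 2 * 4 ^ r * (2 * √(N : ℝ)) := by gcongr; exact sum_inv_sqrt_le N
      _ = 4 ^ (r + 1) * √(N : ℝ) := by ring
      _ ≤ _ := by gcongr; linarith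

/-! ### The Taylor coefficients of the tower -/

/-- Taylor coefficients of the tower of functions `F₀(y) = -y`, `F_{r+1}' = 2 F_r / (1 + y²)`. -/
noncomputable def towerCoeff : ℕ → ℕ → ℝ
  | 0, n => if n = 1 then -1 else 0
  | r + 1, n =>
    (-1) ^ ((n + 3 * r) / 2) * (1 + (-1) ^ (r + n)) / (n : ℝ) * oneTrunc r (n - 1)

theorem towerCoeff_zero_right (r : ℕ) : towerCoeff r 0 = 0 := by
  cases r <;> simp [towerCoeff]

theorem natCast_mul_towerCoeff (r n : ℕ) (hn : n ≠ 0) :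
    (n : ℝ) * towerCoeff (r + 1) n =
      (-1) ^ ((n + 3 * r) / 2) * (1 + (-1) ^ (r + n)) * oneTrunc r (n - 1) := by
  have : (n : ℝ) ≠ 0 := by exact_mod_cast hn
  rw [towerCoeff]
  field_simp

theorem abs_natCast_mul_towerCoeff_le (r n : ℕ) :
    |(n : ℝ) * towerCoeff (r + 1) n| ≤ 2 * 4 ^ r * √(n : ℝ) := by
  rcases Nat.eq_zero_or_pos n with rfl | hn
  · simp
  rw [natCast_mul_towerCoeff r n hn.ne', abs_mul, abs_mul, abs_pow, abs_neg, abs_one, one_pow,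
    one_mul, abs_of_nonneg (one_add_neg_one_pow_nonneg _), abs_of_nonneg (oneTrunc_nonneg _ _)]
  have h := oneTrunc_le r (n - 1)
  rw [Nat.cast_sub hn] at h
  simp only [Nat.cast_one, sub_add_cancel] at h
  calc _ ≤ 2 * (4 ^ r * √(n : ℝ)) := by
        gcongr
        · exact oneTrunc_nonneg _ _
        · exact one_add_neg_one_pow_le _
    _ = _ := by ring

theorem towerCoeff_succ_one (r : ℕ) : towerCoeff (r + 1) 1 = 0 := by
  cases r with
  | zero => simp [towerCoeff]
  | succ r => simp [towerCoeff, oneTrunc]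

/-- This is the coefficient of y^{N+1} in (1+y²) F_{r+1}' = 2 F_r. With the signs stripped off, it
is the one-step recursion in N of the nested sums. -/
theorem towerCoeff_rec (r N : ℕ) :
    2 * towerCoeff r (N + 1) =
      ((N : ℝ) + 2) * towerCoeff (r + 1) (N + 2) + N * towerCoeff (r + 1) N := by
  have h2 : ((N : ℝ) + 2) * towerCoeff (r + 1) (N + 2) =
      (-1) ^ ((N + 3 * r) / 2 + 1) * (1 + (-1) ^ (r + N)) * oneTrunc r (N + 1) := by
    have := natCast_mul_towerCoeff r (N + 2) (by omega)
    push_cast at this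
    rw [this, show (N + 2 + 3 * r) / 2 = (N + 3 * r) / 2 + 1 by omega,
      show r + (N + 2) = (r + N) + 2 by ring, pow_add _ (r + N) 2]
    norm_num
  have h0 : (N : ℝ) * towerCoeff (r + 1) N =
      if N = 0 then 0 else
        (-1) ^ ((N + 3 * r) / 2) * (1 + (-1) ^ (r + N)) * oneTrunc r (N - 1) := by
    split_ifs with h
    · simp [h]
    · exact natCast_mul_towerCoeff r N h
  rw [h2, h0]
  cases r with
  | zero =>
    simp only [towerCoeff, oneTrunc]
    rcases Nat.eq_zero_or_pos N with rfl | hN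
    · norm_num
    · rw [if_neg (by omega), if_neg (by omega)]
      ring
  | succ r =>
    have e1 : towerCoeff (r + 1) (N + 1) = (-1) ^ ((N + 1 + 3 * r) / 2) *
        ((1 + (-1) ^ (r + (N + 1))) / ((N + 1 : ℕ) : ℝ) * oneTrunc r N) := by
      simp only [towerCoeff, Nat.add_sub_cancel]
      ring
    have e2 := oneTrunc_succ_succ r N
    have e3 : (-1 : ℝ) ^ ((N + 3 * (r + 1)) / 2) = -(-1) ^ ((N + 1 + 3 * r) / 2) := by
      rw [show (N + 3 * (r + 1)) / 2 = (N + 1 + 3 * r) / 2 + 1 by omega, pow_succ]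
      ring
    rw [e1, e2, pow_succ _ ((N + 3 * (r + 1)) / 2), e3, show r + 1 + N = r + (N + 1) by ring]
    rcases Nat.even_or_odd (r + (N + 1)) with hp | hp
    · rw [hp.neg_one_pow]
      rcases N with _ | N
      · simp [oneTrunc]
        ring
      -- The new index has the wrong parity for the outermost place, so it contributes nothing.
      · have e4 : oneTrunc (r + 1) (N + 1) = oneTrunc (r + 1) N := by
          rw [oneTrunc_succ_succ]
          have : Odd (r + (N + 1)) := by
            rw [← add_assoc] at hp
            rwa [← Nat.not_even_iff_odd, ← Nat.even_add_one]
          rw [this.neg_one_pow]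
          simp
        simp only [Nat.add_sub_cancel, e4, Nat.add_eq_zero_iff, one_ne_zero, and_false, if_false]
        ring
    · rw [hp.neg_one_pow]
      simp

/-! ### Iterated primitives of the sine, and a comparison principle -/

/-- The iterated primitives, vanishing at `0`, of `x ↦ sin (a x)`. -/
noncomputable def sinPrim : ℕ → ℝ → ℝ → ℝ
  | 0, a, x => Real.sin (a * x)
  | 1, a, x => (1 - Real.cos (a * x)) / a
  | r + 2, a, x => x ^ (r + 1) / ((r + 1).factorial * a) - sinPrim r a x / a ^ 2

theorem sinPrim_succ_apply_zero (r : ℕ) (a : ℝ) : sinPrim (r + 1) a 0 = 0 := by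
  induction r using Nat.twoStepInduction with
  | zero => simp [sinPrim]
  | one => simp [sinPrim]
  | more r ih _ => simp [sinPrim, ih]

theorem hasDerivAt_sinPrim (r : ℕ) {a : ℝ} (ha : a ≠ 0) (x : ℝ) :
    HasDerivAt (sinPrim (r + 1) a) (sinPrim r a x) x := by
  have hlin : HasDerivAt (fun x : ℝ => a * x) a x := by
    simpa using (hasDerivAt_id x).const_mul a
  induction r using Nat.twoStepInduction with
  | zero =>
    have h := ((hlin.cos).const_sub 1).div_const a
    simp only [sinPrim]
    refine h.congr_deriv ?_
    field_simp
  | one =>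
    have h := ((hasDerivAt_id x).div_const a).sub ((hlin.sin).div_const (a ^ 2))
    have e : sinPrim 2 a = (fun x : ℝ => x / a) - fun x => Real.sin (a * x) / a ^ 2 := by
      funext x
      simp [sinPrim]
    rw [e]
    refine h.congr_deriv ?_
    simp only [sinPrim]
    field_simp
  | more r ih _ =>
    have h := (((hasDerivAt_pow (r + 2) x)).div_const ((r + 2).factorial * a)).sub
      (ih.div_const (a ^ 2))
    have e : sinPrim (r + 3) a =
        (fun x : ℝ => x ^ (r + 2) / ((r + 2).factorial * a)) -
          fun x => sinPrim (r + 1) a x / a ^ 2 := by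
      funext x
      simp [sinPrim]
    rw [e]
    refine h.congr_deriv ?_
    simp only [sinPrim]
    have : ((r + 1).factorial : ℝ) ≠ 0 := by positivity
    have h3 : ((r : ℝ) + 2) ≠ 0 := by positivity
    rw [Nat.factorial_succ (r + 1), show r + 2 - 1 = r + 1 by omega]
    push_cast
    rw [show (r : ℝ) + 1 + 1 = r + 2 by ring]
    field_simp

/-- Comparison of a function vanishing at `0` with a primitive of a bound of its derivative. -/
theorem abs_sub_le_of_abs_deriv_le {f f' g g' : ℝ → ℝ} {b : ℝ}
    (hf : ∀ x ∈ Set.Icc 0 b, HasDerivAt f (f' x) x)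
    (hg : ∀ x ∈ Set.Icc 0 b, HasDerivAt g (g' x) x)
    (h : ∀ x ∈ Set.Icc 0 b, |f' x| ≤ g' x) {x : ℝ} (hx : x ∈ Set.Icc 0 b) :
    |f x - f 0| ≤ g x - g 0 := by
  have := image_norm_le_of_norm_deriv_right_le_deriv_boundary' (a := (0 : ℝ)) (b := b)
    (f := fun x => f x - f 0) (f' := f') (B := fun x => g x - g 0) (B' := g')
    (fun x hx => ((hf x hx).continuousAt.sub continuousAt_const).continuousWithinAt)
    (fun x hx => ((hf x ⟨hx.1, hx.2.le⟩).sub_const _).hasDerivWithinAt) (by simp)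
    (fun x hx => ((hg x hx).continuousAt.sub continuousAt_const).continuousWithinAt)
    (fun x hx => ((hg x ⟨hx.1, hx.2.le⟩).sub_const _).hasDerivWithinAt)
    (fun x hx => by simpa using h x ⟨hx.1, hx.2.le⟩) hx
  simpa using this

/-! ### The half-angle substitution and the truncated power series -/

theorem cos_half_pos {x : ℝ} (hx : x ∈ Set.Icc 0 (Real.pi / 2)) : 0 < Real.cos (x / 2) := by
  have := Real.pi_pos
  exact Real.cos_pos_of_mem_Ioo ⟨by linarith [hx.1], by linarith [hx.2]⟩

theorem hasDerivAt_tan_half {x : ℝ} (hx : x ∈ Set.Icc 0 (Real.pi / 2)) :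
    HasDerivAt (fun x : ℝ => Real.tan (x / 2)) ((1 + Real.tan (x / 2) ^ 2) / 2) x := by
  have hc := (cos_half_pos hx).ne'
  have h := (Real.hasDerivAt_tan hc).comp x ((hasDerivAt_id x).div_const 2)
  refine h.congr_deriv ?_
  rw [← Real.inv_one_add_tan_sq hc]
  simp
  ring

theorem tan_half_nonneg {x : ℝ} (hx : x ∈ Set.Icc 0 (Real.pi / 2)) : 0 ≤ Real.tan (x / 2) := by
  have := Real.pi_pos
  exact Real.tan_nonneg_of_nonneg_of_le_pi_div_two (by linarith [hx.1]) (by linarith [hx.2])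

theorem tan_half_le_one {x : ℝ} (hx : x ∈ Set.Icc 0 (Real.pi / 2)) : Real.tan (x / 2) ≤ 1 := by
  have := Real.pi_pos
  have h : x / 2 ≤ Real.pi / 4 := by linarith [hx.2]
  rw [← Real.tan_pi_div_four]
  rcases h.eq_or_lt with h | h
  · rw [h]
  · exact (Real.tan_lt_tan_of_lt_of_lt_pi_div_two (by linarith [hx.1]) (by linarith) h).le

theorem tan_half_le {x : ℝ} (hx : x ∈ Set.Icc 0 (Real.pi / 2)) : Real.tan (x / 2) ≤ x := by
  have h := abs_sub_le_of_abs_deriv_le (f := fun x => Real.tan (x / 2))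
    (g := fun x => x) (g' := fun _ => 1) (fun x hx => hasDerivAt_tan_half hx)
    (fun x _ => hasDerivAt_id x) (fun x hx => ?_) hx
  · simp only [zero_div, Real.tan_zero, sub_zero] at h
    exact (le_abs_self _).trans h
  · have h0 := tan_half_nonneg hx
    have h1 := tan_half_le_one hx
    rw [abs_of_nonneg (by positivity)]
    nlinarith

theorem sin_eq_tan_half {x : ℝ} (hx : x ∈ Set.Icc 0 (Real.pi / 2)) :
    Real.sin x * (1 + Real.tan (x / 2) ^ 2) = 2 * Real.tan (x / 2) := by
  have hc := (cos_half_pos hx).ne'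
  have h1 := Real.sin_sq_add_cos_sq (x / 2)
  have h2 : Real.sin x = 2 * Real.sin (x / 2) * Real.cos (x / 2) := by
    rw [← Real.sin_two_mul]
    congr 1
    ring
  rw [h2, Real.tan_eq_sin_div_cos]
  field_simp
  rw [add_comm, h1, mul_one]

/-- Truncated tower functions in the variable `y = tan (x / 2)`. -/
noncomputable def towerPoly (r N : ℕ) (x : ℝ) : ℝ :=
  ∑ n ∈ Finset.range (N + 1), towerCoeff r n * Real.tan (x / 2) ^ n

/-- The defect of the truncated tower functions from being iterated primitives. -/
noncomputable def towerDefect (r N : ℕ) (x : ℝ) : ℝ :=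
  (N * towerCoeff (r + 1) N * Real.tan (x / 2) ^ (N + 1)
    - (N + 1) * towerCoeff (r + 1) (N + 1) * Real.tan (x / 2) ^ N) / 2

/-- Since dy/dx = (1+y²)/2, the coefficient recursion cancels everything except the boundary of the
truncation: a surplus term in y^{N+1} and a missing term in y^N. At the lower end nothing remains
because the coefficient of y in F_{r+1} is zero. -/
theorem hasDerivAt_towerPoly (r N : ℕ) {x : ℝ} (hx : x ∈ Set.Icc 0 (Real.pi / 2)) :
    HasDerivAt (towerPoly (r + 1) N) (towerPoly r N x + towerDefect r N x) x := by
  induction N with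
  | zero =>
    have e : towerPoly (r + 1) 0 = fun _ => 0 := by
      funext x
      simp [towerPoly, towerCoeff_zero_right]
    rw [e]
    refine (hasDerivAt_const x (0 : ℝ)).congr_deriv ?_
    simp [towerPoly, towerDefect, towerCoeff_zero_right, towerCoeff_succ_one]
  | succ N ih =>
    have e : towerPoly (r + 1) (N + 1) =
        towerPoly (r + 1) N + fun x => towerCoeff (r + 1) (N + 1) * Real.tan (x / 2) ^ (N + 1) := by
      funext x
      simp only [towerPoly, Pi.add_apply]
      rw [Finset.sum_range_succ]
    rw [e]
    refine (ih.add (((hasDerivAt_tan_half hx).pow (N + 1)).const_mul _)).congr_deriv ?_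
    have h := towerCoeff_rec r N
    have e' : towerPoly r (N + 1) x =
        towerPoly r N x + towerCoeff r (N + 1) * Real.tan (x / 2) ^ (N + 1) := by
      simp only [towerPoly]
      rw [Finset.sum_range_succ]
    rw [e']
    simp only [towerDefect, Nat.add_sub_cancel]
    push_cast
    linear_combination (-Real.tan (x / 2) ^ (N + 1) / 2) * h

theorem towerPoly_apply_zero (r N : ℕ) : towerPoly r N 0 = 0 := by
  rw [towerPoly]
  refine Finset.sum_eq_zero fun n _ => ?_
  rcases n with _ | n
  · simp [towerCoeff_zero_right]
  · simp

theorem abs_towerDefect_le (r N : ℕ) {x : ℝ} (hx : x ∈ Set.Icc 0 (Real.pi / 2)) :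
    |towerDefect r N x| ≤ 2 * 4 ^ r * √((N : ℝ) + 1) * Real.tan (x / 2) ^ N := by
  have h0 := tan_half_nonneg hx
  have h1 := tan_half_le_one hx
  have hN := abs_natCast_mul_towerCoeff_le r N
  have hN1 := abs_natCast_mul_towerCoeff_le r (N + 1)
  push_cast at hN1
  have hs : √(N : ℝ) ≤ √((N : ℝ) + 1) := Real.sqrt_le_sqrt (by linarith)
  have hp : Real.tan (x / 2) ^ (N + 1) ≤ Real.tan (x / 2) ^ N :=
    pow_le_pow_of_le_one h0 h1 (by omega)
  rw [towerDefect, abs_div, abs_two, div_le_iff₀ two_pos]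
  refine (abs_sub _ _).trans ?_
  rw [abs_mul, abs_mul (_ * _) (_ ^ N), abs_of_nonneg (pow_nonneg h0 _),
    abs_of_nonneg (pow_nonneg h0 _)]
  calc _ ≤ 2 * 4 ^ r * √((N : ℝ) + 1) * Real.tan (x / 2) ^ N +
        2 * 4 ^ r * √((N : ℝ) + 1) * Real.tan (x / 2) ^ N := by
        gcongr
        exact hN.trans (by gcongr)
    _ = _ := by ring

/-- A primitive of a bound for the defect. -/
theorem hasDerivAt_defect_bound (r N : ℕ) {x : ℝ} (hx : x ∈ Set.Icc 0 (Real.pi / 2)) :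
    HasDerivAt (fun x => 4 * 4 ^ r / √((N : ℝ) + 1) * Real.tan (x / 2) ^ (N + 1))
      (2 * 4 ^ r * √((N : ℝ) + 1) * Real.tan (x / 2) ^ N * (1 + Real.tan (x / 2) ^ 2)) x := by
  refine (((hasDerivAt_tan_half hx).pow (N + 1)).const_mul _).congr_deriv ?_
  have hs : √((N : ℝ) + 1) ^ 2 = N + 1 := Real.sq_sqrt (by positivity)
  have hs0 : √((N : ℝ) + 1) ≠ 0 := by positivity
  push_cast
  field_simp
  rw [hs]
  ring

theorem defect_bound_le (r N : ℕ) {x : ℝ} (hx : x ∈ Set.Icc 0 (Real.pi / 2)) :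
    4 * 4 ^ r / √((N : ℝ) + 1) * Real.tan (x / 2) ^ (N + 1) ≤ 4 * 4 ^ r / √((N : ℝ) + 1) * x := by
  gcongr
  calc _ ≤ Real.tan (x / 2) ^ 1 :=
        pow_le_pow_of_le_one (tan_half_nonneg hx) (tan_half_le_one hx) (by omega)
    _ ≤ x := by rw [pow_one]; exact tan_half_le hx

/-! ### Comparison with the truncated Fourier series -/

/-- Truncated Fourier expansion of the tower functions. -/
noncomputable def towerFourier (r N : ℕ) (x : ℝ) : ℝ :=
  2 * ∑ n ∈ Finset.Icc 1 N, (-1) ^ n * sinPrim r n x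

theorem hasDerivAt_towerFourier (r N : ℕ) (x : ℝ) :
    HasDerivAt (towerFourier (r + 1) N) (towerFourier r N x) x := by
  refine HasDerivAt.const_mul 2 (HasDerivAt.fun_sum fun n hn => ?_)
  refine (hasDerivAt_sinPrim r ?_ x).const_mul _
  have := (Finset.mem_Icc.1 hn).1
  exact_mod_cast (by omega : n ≠ 0)

theorem towerFourier_succ_apply_zero (r N : ℕ) : towerFourier (r + 1) N 0 = 0 := by
  simp [towerFourier, sinPrim_succ_apply_zero]

/-- The Dirichlet kernel of the alternating sine series: multiplication by cos(x/2) makes the sum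
telescope. -/
theorem cos_half_mul_sum_sin (N : ℕ) (x : ℝ) :
    Real.sin (x / 2) + Real.cos (x / 2) * towerFourier 0 N x =
      (-1) ^ N * Real.sin (((N : ℝ) + 1 / 2) * x) := by
  induction N with
  | zero =>
    simp only [towerFourier, pow_zero]
    simp
    ring_nf
  | succ N ih =>
    have e : towerFourier 0 (N + 1) x =
        towerFourier 0 N x + 2 * ((-1) ^ (N + 1) * Real.sin (((N : ℝ) + 1) * x)) := by
      simp only [towerFourier]
      rw [Finset.sum_Icc_succ_top (by omega)]
      simp only [sinPrim]
      push_cast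
      ring
    have h1 : Real.sin (((N : ℝ) + 1 + 1 / 2) * x) = Real.sin (((N : ℝ) + 1) * x) *
        Real.cos (x / 2) + Real.cos (((N : ℝ) + 1) * x) * Real.sin (x / 2) := by
      rw [← Real.sin_add]
      congr 1
      ring
    have h2 : Real.sin (((N : ℝ) + 1 / 2) * x) = Real.sin (((N : ℝ) + 1) * x) *
        Real.cos (x / 2) - Real.cos (((N : ℝ) + 1) * x) * Real.sin (x / 2) := by
      rw [← Real.sin_sub]
      congr 1
      ring
    rw [e]
    push_cast
    rw [h1]
    rw [h2] at ih
    rw [pow_succ]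
    linear_combination ih

theorem towerPoly_zero {N : ℕ} (hN : 1 ≤ N) (x : ℝ) : towerPoly 0 N x = -Real.tan (x / 2) := by
  rw [towerPoly, Finset.sum_eq_single 1]
  · simp [towerCoeff]
  · intro n _ hn
    simp [towerCoeff, hn]
  · intro h
    simp at h
    omega

theorem tower_sub_zero {N : ℕ} (hN : 1 ≤ N) {x : ℝ} (hx : x ∈ Set.Icc 0 (Real.pi / 2)) :
    towerPoly 0 N x - towerFourier 0 N x =
      -((-1) ^ N * Real.sin (((N : ℝ) + 1 / 2) * x) / Real.cos (x / 2)) := by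
  have hc := (cos_half_pos hx).ne'
  rw [towerPoly_zero hN, ← cos_half_mul_sum_sin, Real.tan_eq_sin_div_cos]
  field_simp
  ring

theorem half_le_cos_half {x : ℝ} (hx : x ∈ Set.Icc 0 (Real.pi / 2)) :
    1 / 2 ≤ Real.cos (x / 2) ^ 2 := by
  have hc := cos_half_pos hx
  have h1 := tan_half_le_one hx
  have h0 := tan_half_nonneg hx
  rw [← Real.inv_one_add_tan_sq hc.ne', one_div]
  gcongr
  nlinarith

theorem one_div_add_half_le (N : ℕ) : 1 / ((N : ℝ) + 1 / 2) ≤ 2 / √((N : ℝ) + 1) := by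
  have hs : √((N : ℝ) + 1) ≤ N + 1 := by
    rw [Real.sqrt_le_left (by positivity)]
    nlinarith [(Nat.cast_nonneg N : (0 : ℝ) ≤ N)]
  rw [div_le_div_iff₀ (by positivity) (by positivity)]
  linarith [(Nat.cast_nonneg N : (0 : ℝ) ≤ N)]

/-- At level 0 the difference oscillates with frequency N + 1/2 without tending to zero. One
integration by parts, legitimate because cos(x/2) stays away from 0, gains the decay in N. -/
theorem tower_sub_one_le {N : ℕ} (hN : 1 ≤ N) {x : ℝ} (hx : x ∈ Set.Icc 0 (Real.pi / 2)) :
    |towerPoly 1 N x - towerFourier 1 N x| ≤ 20 / √((N : ℝ) + 1) := by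
  set M : ℝ := (N : ℝ) + 1 / 2 with hM
  have hM0 : 0 < M := by positivity
  set σ : ℝ := (-1) ^ N with hσ
  have hσ1 : |σ| = 1 := by simp [hσ]
  have hMS : 1 / M ≤ 2 / √((N : ℝ) + 1) := one_div_add_half_le N
  have hS : 0 < √((N : ℝ) + 1) := by positivity
  -- The boundary term of the integration by parts: its derivative is the level 0 difference plus a
  -- remainder of order 1/M.
  let g : ℝ → ℝ := fun x => σ * Real.cos (M * x) / (M * Real.cos (x / 2))
  have hg : ∀ x ∈ Set.Icc 0 (Real.pi / 2), HasDerivAt g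
      (-(σ * Real.sin (M * x) / Real.cos (x / 2)) +
        σ * Real.cos (M * x) * Real.sin (x / 2) / (2 * M * Real.cos (x / 2) ^ 2)) x := by
    intro x hx
    have hc := (cos_half_pos hx).ne'
    have h1 : HasDerivAt (fun x : ℝ => M * x) M x := by
      simpa using (hasDerivAt_id x).const_mul M
    have h2 : HasDerivAt (fun x : ℝ => x / 2) (1 / 2) x := (hasDerivAt_id x).div_const 2
    refine ((h1.cos.const_mul σ).div (h2.cos.const_mul M) (by positivity)).congr_deriv ?_
    field_simp
    ring
  have hgb : ∀ x ∈ Set.Icc 0 (Real.pi / 2), |g x| ≤ 4 / √((N : ℝ) + 1) := by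
    intro x hx
    have hc := cos_half_pos hx
    have hc2 := half_le_cos_half hx
    have hc3 : 1 / 2 ≤ Real.cos (x / 2) := by nlinarith [Real.cos_le_one (x / 2)]
    simp only [g]
    rw [abs_div, abs_mul, hσ1, one_mul, abs_of_pos (mul_pos hM0 hc)]
    calc _ ≤ 1 / (M * (1 / 2)) := by
          gcongr
          exact Real.abs_cos_le_one _
      _ = 2 * (1 / M) := by field_simp
      _ ≤ 2 * (2 / √((N : ℝ) + 1)) := by gcongr
      _ = _ := by ring
  have key := abs_sub_le_of_abs_deriv_le
    (f := fun x => towerPoly 1 N x - towerFourier 1 N x - g x)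
    (f' := fun x => towerDefect 0 N x -
      σ * Real.cos (M * x) * Real.sin (x / 2) / (2 * M * Real.cos (x / 2) ^ 2))
    (g := fun x => 4 * 4 ^ 0 / √((N : ℝ) + 1) * Real.tan (x / 2) ^ (N + 1) +
      2 / √((N : ℝ) + 1) * x)
    (g' := fun x => 2 * 4 ^ 0 * √((N : ℝ) + 1) * Real.tan (x / 2) ^ N *
      (1 + Real.tan (x / 2) ^ 2) + 2 / √((N : ℝ) + 1))
    (fun x hx => ?_) (fun x hx => ?_) (fun x hx => ?_) hx
  · have h0 := hgb x hx
    have h00 := hgb 0 ⟨le_rfl, by positivity⟩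
    have hb := defect_bound_le 0 N hx
    have hx2 : x ≤ 2 := by linarith [hx.2, Real.pi_le_four]
    have e1 : towerPoly 1 N 0 = 0 := towerPoly_apply_zero 1 N
    have e2 : towerFourier 1 N 0 = 0 := towerFourier_succ_apply_zero 0 N
    have hxb : 4 * 4 ^ 0 / √((N : ℝ) + 1) * x ≤ 8 / √((N : ℝ) + 1) := by
      rw [div_mul_eq_mul_div]
      gcongr
      linarith
    have hxc : 2 / √((N : ℝ) + 1) * x ≤ 4 / √((N : ℝ) + 1) := by
      rw [div_mul_eq_mul_div]
      gcongr
      linarith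
    simp only [e1, e2, zero_div, Real.tan_zero, zero_pow (Nat.succ_ne_zero N), mul_zero, add_zero,
      sub_zero, zero_sub] at key
    -- In this order: the power series defect, the remainder of the integration by parts (both with
    -- x ≤ 2), and the values of g at x and at 0.
    have h20 : 20 / √((N : ℝ) + 1) = 8 / √((N : ℝ) + 1) + 4 / √((N : ℝ) + 1) +
        4 / √((N : ℝ) + 1) + 4 / √((N : ℝ) + 1) := by ring
    rw [abs_le] at key h0 h00 ⊢
    constructor <;> linarith [key.1, key.2, h0.1, h0.2, h00.1, h00.2]
  · have h := ((hasDerivAt_towerPoly 0 N hx).sub (hasDerivAt_towerFourier 0 N x)).sub (hg x hx)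
    refine h.congr_deriv ?_
    have := tower_sub_zero hN hx
    linear_combination this
  · refine ((hasDerivAt_defect_bound 0 N hx).add ((hasDerivAt_id x).const_mul _)).congr_deriv ?_
    simp
  · have h1 := abs_towerDefect_le 0 N hx
    have h0 := tan_half_nonneg hx
    refine (abs_sub _ _).trans (add_le_add (h1.trans ?_) ?_)
    · refine le_mul_of_one_le_right (by positivity) ?_
      nlinarith
    · have hc2 := half_le_cos_half hx
      rw [abs_div, abs_mul, abs_mul, hσ1, one_mul,
        abs_of_pos (mul_pos (by positivity) (pow_pos (cos_half_pos hx) 2) :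
          0 < 2 * M * Real.cos (x / 2) ^ 2)]
      refine le_trans ?_ hMS
      calc _ ≤ 1 * 1 / (2 * M * (1 / 2)) := by
            gcongr
            · exact Real.abs_cos_le_one _
            · exact Real.abs_sin_le_one _
        _ = _ := by field_simp

/-- The factor x is what allows division by sin x. It appears once a uniform bound has been
integrated from 0, hence only from level 2 on. -/
theorem tower_sub_le (r : ℕ) : ∃ C : ℝ, 0 ≤ C ∧ ∀ N : ℕ, 1 ≤ N → ∀ x ∈ Set.Icc 0 (Real.pi / 2),
    |towerPoly (r + 2) N x - towerFourier (r + 2) N x| ≤ C * x / √((N : ℝ) + 1) := by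
  have step : ∀ (s : ℕ) (K : ℝ), 0 ≤ K →
      (∀ N : ℕ, 1 ≤ N → ∀ x ∈ Set.Icc 0 (Real.pi / 2),
        |towerPoly (s + 1) N x - towerFourier (s + 1) N x| ≤ K / √((N : ℝ) + 1)) →
      ∀ N : ℕ, 1 ≤ N → ∀ x ∈ Set.Icc 0 (Real.pi / 2),
        |towerPoly (s + 2) N x - towerFourier (s + 2) N x| ≤
          (K + 4 * 4 ^ (s + 1)) * x / √((N : ℝ) + 1) := by
    intro s K hK h N hN x hx
    have key := abs_sub_le_of_abs_deriv_le
      (f := fun x => towerPoly (s + 2) N x - towerFourier (s + 2) N x)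
      (f' := fun x => towerPoly (s + 1) N x + towerDefect (s + 1) N x - towerFourier (s + 1) N x)
      (g := fun x => 4 * 4 ^ (s + 1) / √((N : ℝ) + 1) * Real.tan (x / 2) ^ (N + 1) +
        K / √((N : ℝ) + 1) * x)
      (g' := fun x => 2 * 4 ^ (s + 1) * √((N : ℝ) + 1) * Real.tan (x / 2) ^ N *
        (1 + Real.tan (x / 2) ^ 2) + K / √((N : ℝ) + 1))
      (fun x hx => (hasDerivAt_towerPoly (s + 1) N hx).sub (hasDerivAt_towerFourier (s + 1) N x))
      (fun x hx => ?_) (fun x hx => ?_) hx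
    · have hb := defect_bound_le (s + 1) N hx
      have e1 : towerPoly (s + 2) N 0 = 0 := towerPoly_apply_zero _ N
      have e2 : towerFourier (s + 2) N 0 = 0 := towerFourier_succ_apply_zero _ N
      simp only [e1, e2, zero_div, Real.tan_zero, sub_zero, mul_zero, add_zero] at key
      rw [zero_pow (by omega), mul_zero, sub_zero] at key
      refine key.trans ((add_le_add_left hb _).trans (le_of_eq ?_))
      ring
    · refine ((hasDerivAt_defect_bound (s + 1) N hx).add
        ((hasDerivAt_id x).const_mul _)).congr_deriv ?_
      simp
    · have h1 := abs_towerDefect_le (s + 1) N hx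
      have h2 := h N hN x hx
      have h0 := tan_half_nonneg hx
      have h3 : 2 * 4 ^ (s + 1) * √((N : ℝ) + 1) * Real.tan (x / 2) ^ N ≤
          2 * 4 ^ (s + 1) * √((N : ℝ) + 1) * Real.tan (x / 2) ^ N *
          (1 + Real.tan (x / 2) ^ 2) := by
        refine le_mul_of_one_le_right (by positivity) ?_
        nlinarith
      rw [add_sub_right_comm]
      refine (abs_add_le _ _).trans ?_
      linarith
  induction r with
  | zero =>
    exact ⟨_, by positivity, step 0 20 (by norm_num) fun N hN x hx => tower_sub_one_le hN hx⟩
  | succ r ih =>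
    obtain ⟨C, hC, h⟩ := ih
    refine ⟨_, by positivity, step (r + 1) (C * 2) (by positivity) fun N hN x hx =>
      (h N hN x hx).trans ?_⟩
    have hx2 : x ≤ 2 := by linarith [hx.2, Real.pi_le_four]
    gcongr

/-! ### Integration against 1/sin x -/

open MeasureTheory in
theorem intervalIntegrable_div_sin {f : ℝ → ℝ} (hf : Measurable f) {C : ℝ}
    (h : ∀ x ∈ Set.Icc 0 (Real.pi / 2), |f x| ≤ C * x) :
    IntervalIntegrable (fun x => f x / Real.sin x) volume 0 (Real.pi / 2) := by
  have hpi := Real.pi_pos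
  rw [intervalIntegrable_iff_integrableOn_Ioc_of_le (by positivity)]
  refine Measure.integrableOn_of_bounded (M := C * (Real.pi / 2)) (by simp)
    (hf.div Real.measurable_sin).aestronglyMeasurable ?_
  refine (ae_restrict_iff' measurableSet_Ioc).2 (Filter.Eventually.of_forall fun x hx => ?_)
  -- Jordan's inequality: a numerator that is O(x) leaves a bounded quotient.
  have hs : 2 / Real.pi * x ≤ Real.sin x := Real.mul_le_sin hx.1.le hx.2
  have hx0 : 0 < 2 / Real.pi * x := mul_pos (by positivity) hx.1
  have hs0 : 0 < Real.sin x := hx0.trans_le hs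
  have hC : 0 ≤ C := by
    have := (abs_nonneg _).trans (h x ⟨hx.1.le, hx.2⟩)
    exact nonneg_of_mul_nonneg_left this hx.1
  rw [Real.norm_eq_abs, abs_div, abs_of_pos hs0, div_le_iff₀ hs0]
  calc _ ≤ C * x := h x ⟨hx.1.le, hx.2⟩
    _ = C * (Real.pi / 2) * (2 / Real.pi * x) := by field_simp
    _ ≤ _ := by gcongr

theorem intervalIntegrable_fun_sum {a b : ℝ} (s : Finset ℕ) {f : ℕ → ℝ → ℝ}
    (h : ∀ i ∈ s, IntervalIntegrable (f i) MeasureTheory.volume a b) :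
    IntervalIntegrable (fun x => ∑ i ∈ s, f i x) MeasureTheory.volume a b := by
  have := IntervalIntegrable.sum s h
  rwa [Finset.sum_fn] at this

theorem sin_pos_of_mem {x : ℝ} (hx : x ∈ Set.Ioc 0 (Real.pi / 2)) : 0 < Real.sin x :=
  Real.sin_pos_of_pos_of_lt_pi hx.1 (by linarith [hx.2, Real.pi_pos])

theorem intervalIntegrable_tan_half_pow (n : ℕ) :
    IntervalIntegrable (fun x => Real.tan (x / 2) ^ (n + 1) / Real.sin x) MeasureTheory.volume 0
      (Real.pi / 2) := by
  refine intervalIntegrable_div_sin (C := 1) ?_ fun x hx => ?_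
  · have : Measurable Real.tan := by
      have e : Real.tan = fun x => Real.sin x / Real.cos x := by
        funext x
        exact Real.tan_eq_sin_div_cos x
      rw [e]
      exact Real.measurable_sin.div Real.measurable_cos
    exact (this.comp (measurable_id.div_const 2)).pow_const _
  · rw [abs_of_nonneg (pow_nonneg (tan_half_nonneg hx) _), one_mul]
    refine le_trans ?_ (tan_half_le hx)
    exact pow_le_of_le_one (tan_half_nonneg hx) (tan_half_le_one hx) (by omega)

/-- In the variable y the measure dx/sin x is dy/y, and x = π/2 corresponds to y = 1. -/
theorem integral_tan_half_pow (n : ℕ) :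
    ∫ x in (0 : ℝ)..(Real.pi / 2), Real.tan (x / 2) ^ (n + 1) / Real.sin x = 1 / ((n : ℝ) + 1) := by
  have hpi := Real.pi_pos
  have h := intervalIntegral.integral_eq_sub_of_hasDerivAt_of_le (a := 0) (b := Real.pi / 2)
    (f := fun x => Real.tan (x / 2) ^ (n + 1) / ((n : ℝ) + 1))
    (f' := fun x => Real.tan (x / 2) ^ (n + 1) / Real.sin x) (by positivity)
    (fun x hx => (((hasDerivAt_tan_half hx).pow (n + 1)).div_const
      ((n : ℝ) + 1)).continuousAt.continuousWithinAt)
    (fun x hx => ?_) (intervalIntegrable_tan_half_pow n)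
  · rw [h]
    simp only [zero_div, Real.tan_zero, zero_pow (Nat.succ_ne_zero n)]
    rw [show Real.pi / 2 / 2 = Real.pi / 4 by ring, Real.tan_pi_div_four]
    simp
  · have hx' : x ∈ Set.Icc 0 (Real.pi / 2) := ⟨hx.1.le, hx.2.le⟩
    refine (((hasDerivAt_tan_half hx').pow (n + 1)).div_const ((n : ℝ) + 1)).congr_deriv ?_
    have hs := (sin_pos_of_mem ⟨hx.1, hx.2.le⟩).ne'
    have he := sin_eq_tan_half hx'
    have hn : (n : ℝ) + 1 ≠ 0 := by positivity
    push_cast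
    field_simp
    linear_combination Real.tan (x / 2) ^ n * he

theorem sum_towerPoly_eq (r N : ℕ) (x : ℝ) : towerPoly r N x =
    ∑ n ∈ Finset.range N, towerCoeff r (n + 1) * Real.tan (x / 2) ^ (n + 1) := by
  rw [towerPoly, Finset.sum_range_succ']
  simp [towerCoeff_zero_right]

theorem intervalIntegrable_towerPoly (r N : ℕ) :
    IntervalIntegrable (fun x => towerPoly r N x / Real.sin x) MeasureTheory.volume 0
      (Real.pi / 2) := by
  simp only [sum_towerPoly_eq, Finset.sum_div, mul_div_assoc]
  exact intervalIntegrable_fun_sum _ fun n _ => (intervalIntegrable_tan_half_pow n).const_mul _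

theorem integral_towerPoly (r N : ℕ) :
    ∫ x in (0 : ℝ)..(Real.pi / 2), towerPoly r N x / Real.sin x =
      ∑ n ∈ Finset.range N, towerCoeff r (n + 1) / ((n : ℝ) + 1) := by
  simp only [sum_towerPoly_eq, Finset.sum_div, mul_div_assoc]
  rw [intervalIntegral.integral_finsetSum fun n _ =>
    (intervalIntegrable_tan_half_pow n).const_mul _]
  refine Finset.sum_congr rfl fun n _ => ?_
  rw [intervalIntegral.integral_const_mul, integral_tan_half_pow]
  ring

theorem sum_Icc_one_eq (f : ℕ → ℝ) (N : ℕ) :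
    ∑ n ∈ Finset.Icc 1 N, f n = ∑ n ∈ Finset.range N, f (n + 1) := by
  induction N with
  | zero => simp
  | succ N ih => rw [Finset.sum_Icc_succ_top (by omega), Finset.sum_range_succ, ih]

/-- Exact at every finite N. Integrating y^n dy/y adds one more factor 1/n to the Taylor
coefficient, which makes the outer exponent 2; the sign of the coefficient at level 2ℓ+1 is
(-1)^{n/2} times (-1)^{3ℓ} for even n. -/
theorem multSTrunc_eq_integral (ℓ N : ℕ) :
    multSTrunc (barFirst (2 * ℓ)) (twoOnes (2 * ℓ)) N =
      (-1) ^ ℓ * ∫ x in (0 : ℝ)..(Real.pi / 2), towerPoly (2 * ℓ + 1) N x / Real.sin x := by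
  rw [integral_towerPoly, multSTrunc_eq, sum_Icc_one_eq, Finset.mul_sum]
  refine Finset.sum_congr rfl fun n _ => ?_
  have h1 : (n + 1 + 3 * (2 * ℓ)) / 2 = (n + 1) / 2 + (ℓ + 2 * ℓ) := by omega
  have h2 : (-1 : ℝ) ^ (2 * ℓ) = 1 := by rw [pow_mul]; simp
  have h3 : (-1 : ℝ) ^ ℓ * (-1) ^ ℓ = 1 := by rw [← mul_pow]; simp
  rw [towerCoeff, h1, pow_add _ ((n + 1) / 2), pow_add _ ℓ, pow_add (-1 : ℝ) (2 * ℓ), h2,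
    Nat.add_sub_cancel]
  push_cast
  field_simp
  linear_combination (-(1 + (-1) ^ (n + 1)) * oneTrunc (2 * ℓ) n) * h3

theorem continuous_sinPrim (r : ℕ) {a : ℝ} (ha : a ≠ 0) : Continuous (sinPrim r a) := by
  cases r with
  | zero =>
    simp only [sinPrim]
    fun_prop
  | succ r => exact continuous_iff_continuousAt.2 fun x => (hasDerivAt_sinPrim r ha x).continuousAt

theorem intervalIntegrable_sinPrim (r : ℕ) {a : ℝ} (ha : a ≠ 0) :
    IntervalIntegrable (fun x => sinPrim (r + 1) a x / Real.sin x) MeasureTheory.volume 0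
      (Real.pi / 2) := by
  obtain ⟨C, hC⟩ := (isCompact_Icc (a := (0 : ℝ)) (b := Real.pi / 2)).exists_bound_of_continuousOn
    (continuous_sinPrim r ha).continuousOn
  refine intervalIntegrable_div_sin (C := C) (continuous_sinPrim (r + 1) ha).measurable
    fun x hx => ?_
  have := abs_sub_le_of_abs_deriv_le (f := sinPrim (r + 1) a) (g := fun x => C * x)
    (g' := fun _ => C) (fun x _ => hasDerivAt_sinPrim r ha x)
    (fun x _ => by simpa using (hasDerivAt_id x).const_mul C) (fun x hx => hC x hx) hx
  simpa [sinPrim_succ_apply_zero] using this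

/-- The integral of an iterated primitive of `sin (a x)` against `1 / sin x`. -/
noncomputable def sinPrimIntegral (r : ℕ) (a : ℝ) : ℝ :=
  ∫ x in (0 : ℝ)..(Real.pi / 2), sinPrim r a x / Real.sin x

/-- `∫ x^m / m! / sin x` over `[0, π / 2]`. -/
noncomputable def powIntegral (m : ℕ) : ℝ :=
  ∫ x in (0 : ℝ)..(Real.pi / 2), x ^ m / (m.factorial : ℝ) / Real.sin x

/-- `∫ (1 - cos (n x)) / sin x` over `[0, π / 2]`. -/
noncomputable def cosIntegral (n : ℕ) : ℝ :=
  ∫ x in (0 : ℝ)..(Real.pi / 2), (1 - Real.cos (n * x)) / Real.sin x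

theorem natCast_ne_zero_of_mem {n N : ℕ} (hn : n ∈ Finset.Icc 1 N) : (n : ℝ) ≠ 0 := by
  have := (Finset.mem_Icc.1 hn).1
  exact_mod_cast (by omega : n ≠ 0)

theorem intervalIntegrable_towerFourier (r N : ℕ) :
    IntervalIntegrable (fun x => towerFourier (r + 1) N x / Real.sin x) MeasureTheory.volume 0
      (Real.pi / 2) := by
  simp only [towerFourier, Finset.sum_div, mul_div_assoc]
  exact (intervalIntegrable_fun_sum _ fun n hn =>
    (intervalIntegrable_sinPrim r (natCast_ne_zero_of_mem hn)).const_mul _).const_mul _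

theorem integral_towerFourier (r N : ℕ) :
    ∫ x in (0 : ℝ)..(Real.pi / 2), towerFourier (r + 1) N x / Real.sin x =
      2 * ∑ n ∈ Finset.Icc 1 N, (-1) ^ n * sinPrimIntegral (r + 1) n := by
  simp only [towerFourier, Finset.sum_div, mul_div_assoc]
  rw [intervalIntegral.integral_const_mul, intervalIntegral.integral_finsetSum fun n hn =>
    (intervalIntegrable_sinPrim r (natCast_ne_zero_of_mem hn)).const_mul _]
  simp only [intervalIntegral.integral_const_mul, sinPrimIntegral]

/-- Transfers the limit to the Fourier side without presupposing convergence of either side. -/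
theorem tendsto_multSTrunc_sub {ℓ : ℕ} (hℓ : 1 ≤ ℓ) :
    Tendsto (fun N => multSTrunc (barFirst (2 * ℓ)) (twoOnes (2 * ℓ)) N -
      (-1) ^ ℓ * (2 * ∑ n ∈ Finset.Icc 1 N, (-1) ^ n * sinPrimIntegral (2 * ℓ + 1) n))
      atTop (𝓝 0) := by
  have hpi := Real.pi_pos
  obtain ⟨C, hC, h⟩ := tower_sub_le (2 * ℓ - 1)
  rw [show 2 * ℓ - 1 + 2 = 2 * ℓ + 1 by omega] at h
  have hlim : Tendsto (fun N : ℕ => C * (Real.pi / 2) * |Real.pi / 2 - 0| / √((N : ℝ) + 1)) atTop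
      (𝓝 0) :=
    tendsto_const_nhds.div_atTop (Real.tendsto_sqrt_atTop.comp
      (tendsto_atTop_add_const_right _ _ tendsto_natCast_atTop_atTop))
  refine squeeze_zero_norm' ?_ hlim
  filter_upwards [eventually_ge_atTop 1] with N hN
  rw [multSTrunc_eq_integral, ← integral_towerFourier, ← mul_sub,
    ← intervalIntegral.integral_sub (intervalIntegrable_towerPoly _ _)
    (intervalIntegrable_towerFourier _ _), norm_mul, norm_pow, norm_neg, norm_one, one_pow, one_mul]
  refine (intervalIntegral.norm_integral_le_of_norm_le_const
    (C := C * (Real.pi / 2) / √((N : ℝ) + 1)) fun x hx => ?_).trans (le_of_eq (by ring))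
  rw [Set.uIoc_of_le (by positivity)] at hx
  have hs : 2 / Real.pi * x ≤ Real.sin x := Real.mul_le_sin hx.1.le hx.2
  have hs0 := sin_pos_of_mem hx
  rw [← sub_div, Real.norm_eq_abs, abs_div, abs_of_pos hs0, div_le_iff₀ hs0]
  calc _ ≤ C * x / √((N : ℝ) + 1) := h N hN x ⟨hx.1.le, hx.2⟩
    _ = C * (Real.pi / 2) / √((N : ℝ) + 1) * (2 / Real.pi * x) := by field_simp
    _ ≤ _ := by gcongr

theorem intervalIntegrable_pow (m : ℕ) :
    IntervalIntegrable (fun x => x ^ (m + 1) / ((m + 1).factorial : ℝ) / Real.sin x)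
      MeasureTheory.volume 0 (Real.pi / 2) := by
  refine intervalIntegrable_div_sin (C := 2 ^ m) (by fun_prop) fun x hx => ?_
  have hx2 : x ≤ 2 := by linarith [hx.2, Real.pi_le_four]
  have hx0 := hx.1
  rw [abs_of_nonneg (by positivity)]
  calc _ ≤ x ^ (m + 1) / 1 := by
        gcongr
        exact_mod_cast Nat.factorial_pos _
    _ = x ^ m * x := by rw [div_one, pow_succ]
    _ ≤ _ := by gcongr

theorem sinPrimIntegral_one (n : ℕ) : sinPrimIntegral 1 n = cosIntegral n / n := by
  rw [sinPrimIntegral, cosIntegral, ← intervalIntegral.integral_div]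
  refine intervalIntegral.integral_congr fun x _ => ?_
  simp only [sinPrim]
  ring

theorem sinPrimIntegral_add_two (r : ℕ) {a : ℝ} (ha : a ≠ 0) :
    sinPrimIntegral (r + 3) a = powIntegral (r + 2) / a - sinPrimIntegral (r + 1) a / a ^ 2 := by
  rw [sinPrimIntegral, powIntegral, sinPrimIntegral, ← intervalIntegral.integral_div,
    ← intervalIntegral.integral_div, ← intervalIntegral.integral_sub
    ((intervalIntegrable_pow (r + 1)).div_const _) ((intervalIntegrable_sinPrim r ha).div_const _)]
  refine intervalIntegral.integral_congr fun x _ => ?_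
  simp only [sinPrim]
  field_simp

/-- The two-step recursion of the primitives unwound down to level 1. Each step divides by -n² and
releases one moment of 1/sin x. -/
theorem sinPrimIntegral_eq (ℓ : ℕ) {n : ℕ} (hn : n ≠ 0) :
    (-1) ^ ℓ * sinPrimIntegral (2 * ℓ + 1) n = cosIntegral n / (n : ℝ) ^ (2 * ℓ + 1) +
      ∑ i ∈ Finset.range ℓ, (-1) ^ (i + 1) * powIntegral (2 * i + 2) /
        (n : ℝ) ^ (2 * (ℓ - i) - 1) := by
  have hn' : (n : ℝ) ≠ 0 := by exact_mod_cast hn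
  induction ℓ with
  | zero => simp [sinPrimIntegral_one]
  | succ ℓ ih =>
    have e : ∑ i ∈ Finset.range ℓ, (-1) ^ (i + 1) * powIntegral (2 * i + 2) /
        (n : ℝ) ^ (2 * (ℓ + 1 - i) - 1) = (∑ i ∈ Finset.range ℓ, (-1) ^ (i + 1) *
        powIntegral (2 * i + 2) / (n : ℝ) ^ (2 * (ℓ - i) - 1)) / (n : ℝ) ^ 2 := by
      rw [Finset.sum_div]
      refine Finset.sum_congr rfl fun i hi => ?_
      rw [Finset.mem_range] at hi
      rw [div_div, ← pow_add]
      congr 2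
      omega
    rw [Finset.sum_range_succ, e, show 2 * (ℓ + 1) + 1 = 2 * ℓ + 3 by ring,
      sinPrimIntegral_add_two _ hn', show 2 * (ℓ + 1 - ℓ) - 1 = 1 by omega, pow_succ,
      show 2 * ℓ + 3 = 2 * ℓ + 1 + 2 by ring, pow_add (n : ℝ) (2 * ℓ + 1) 2, ← div_div]
    linear_combination (1 / (n : ℝ) ^ 2) * ih

/-! ### The integrals of (1 - cos nx)/sin x -/

theorem intervalIntegrable_cos (n : ℕ) :
    IntervalIntegrable (fun x => (1 - Real.cos (n * x)) / Real.sin x)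
      MeasureTheory.volume 0 (Real.pi / 2) := by
  rcases Nat.eq_zero_or_pos n with rfl | hn
  · simp
  have hn' : (n : ℝ) ≠ 0 := by exact_mod_cast hn.ne'
  refine ((intervalIntegrable_sinPrim 0 hn').const_mul n).congr fun x _ => ?_
  simp only [sinPrim]
  field_simp

theorem cosIntegral_zero : cosIntegral 0 = 0 := by
  simp [cosIntegral]

theorem cosIntegral_one : cosIntegral 1 = Real.log 2 := by
  have hpi := Real.pi_pos
  have h2 : ∀ x : ℝ, HasDerivAt (fun x : ℝ => x / 2) (1 / 2) x := fun x =>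
    (hasDerivAt_id x).div_const 2
  have hd : ∀ x ∈ Set.Icc 0 (Real.pi / 2), HasDerivAt (fun x => -(2 * Real.log (Real.cos (x / 2))))
      (Real.tan (x / 2)) x := by
    intro x hx
    have hc := (cos_half_pos hx).ne'
    refine (((h2 x).cos.log hc).const_mul 2).neg.congr_deriv ?_
    rw [Real.tan_eq_sin_div_cos]
    ring
  have h := intervalIntegral.integral_eq_sub_of_hasDerivAt_of_le (a := 0) (b := Real.pi / 2)
    (f := fun x => -(2 * Real.log (Real.cos (x / 2))))
    (f' := fun x => (1 - Real.cos ((1 : ℕ) * x)) / Real.sin x) (by positivity)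
    (fun x hx => (hd x hx).continuousAt.continuousWithinAt)
    (fun x hx => ?_) (intervalIntegrable_cos 1)
  · rw [cosIntegral, h]
    rw [show Real.pi / 2 / 2 = Real.pi / 4 by ring, Real.cos_pi_div_four,
      Real.log_div (by positivity) (by norm_num), Real.log_sqrt (by norm_num)]
    simp
    ring
  · have hx' : x ∈ Set.Icc 0 (Real.pi / 2) := ⟨hx.1.le, hx.2.le⟩
    refine (hd x hx').congr_deriv ?_
    have hs := (sin_pos_of_mem ⟨hx.1, hx.2.le⟩).ne'
    have hc := (cos_half_pos hx').ne'
    have e1 : Real.sin x = 2 * Real.sin (x / 2) * Real.cos (x / 2) := by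
      rw [← Real.sin_two_mul]
      congr 1
      ring
    have e2 : Real.cos x = 1 - 2 * Real.sin (x / 2) ^ 2 := by
      have := Real.cos_sq' (x / 2)
      have h3 := Real.cos_two_mul (x / 2)
      rw [show 2 * (x / 2) = x by ring] at h3
      linarith
    rw [Nat.cast_one, one_mul, eq_div_iff hs, e1, e2, Real.tan_eq_sin_div_cos]
    field_simp
    ring

/-- From cos(nx) - cos((n+2)x) = 2 sin((n+1)x) sin x, which cancels the denominator. -/
theorem cosIntegral_add_two (n : ℕ) : cosIntegral (n + 2) =
    cosIntegral n + 2 * (1 - Real.cos (((n : ℝ) + 1) * (Real.pi / 2))) / ((n : ℝ) + 1) := by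
  have hpi := Real.pi_pos
  have hn : (n : ℝ) + 1 ≠ 0 := by positivity
  rw [cosIntegral, cosIntegral, ← sub_eq_iff_eq_add', ← intervalIntegral.integral_sub
    (intervalIntegrable_cos _) (intervalIntegrable_cos _)]
  have e : ∫ x in (0 : ℝ)..(Real.pi / 2), ((1 - Real.cos ((n + 2 : ℕ) * x)) / Real.sin x -
      (1 - Real.cos (n * x)) / Real.sin x) =
      ∫ x in (0 : ℝ)..(Real.pi / 2), 2 * Real.sin (((n : ℝ) + 1) * x) := by
    refine intervalIntegral.integral_congr_ae (Filter.Eventually.of_forall fun x hx => ?_)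
    rw [Set.uIoc_of_le (by positivity)] at hx
    have hs := (sin_pos_of_mem hx).ne'
    rw [← sub_div, div_eq_iff hs]
    have h1 : Real.cos ((n + 2 : ℕ) * x) = Real.cos (((n : ℝ) + 1) * x) * Real.cos x -
        Real.sin (((n : ℝ) + 1) * x) * Real.sin x := by
      rw [← Real.cos_add]
      congr 1
      push_cast
      ring
    have h2 : Real.cos (n * x) = Real.cos (((n : ℝ) + 1) * x) * Real.cos x +
        Real.sin (((n : ℝ) + 1) * x) * Real.sin x := by
      rw [← Real.cos_sub]
      congr 1
      ring
    rw [h1, h2]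
    ring
  rw [e, intervalIntegral.integral_const_mul]
  have h3 : ∫ x in (0 : ℝ)..(Real.pi / 2), Real.sin (((n : ℝ) + 1) * x) =
      (1 - Real.cos (((n : ℝ) + 1) * (Real.pi / 2))) / ((n : ℝ) + 1) := by
    rw [intervalIntegral.integral_comp_mul_left (fun x => Real.sin x) hn]
    simp
    ring
  rw [h3]
  ring

theorem cosIntegral_even (k : ℕ) :
    cosIntegral (2 * k) = 2 * ∑ i ∈ Finset.range k, 1 / (2 * (i : ℝ) + 1) := by
  induction k with
  | zero => simp [cosIntegral_zero]
  | succ k ih =>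
    rw [show 2 * (k + 1) = 2 * k + 2 by ring, cosIntegral_add_two, ih, Finset.sum_range_succ]
    have : Real.cos (((2 * k : ℕ) + 1 : ℝ) * (Real.pi / 2)) = 0 := by
      push_cast
      rw [show (2 * (k : ℝ) + 1) * (Real.pi / 2) = k * Real.pi + Real.pi / 2 by ring,
        Real.cos_add_pi_div_two, Real.sin_nat_mul_pi, neg_zero]
    rw [this]
    push_cast
    ring

theorem cosIntegral_odd (k : ℕ) :
    cosIntegral (2 * k + 1) =
      Real.log 2 + ∑ i ∈ Finset.Icc 1 k, (1 - (-1) ^ i) / (i : ℝ) := by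
  induction k with
  | zero => simp [cosIntegral_one]
  | succ k ih =>
    rw [show 2 * (k + 1) + 1 = 2 * k + 1 + 2 by ring, cosIntegral_add_two, ih,
      Finset.sum_Icc_succ_top (by omega)]
    have : Real.cos (((2 * k + 1 : ℕ) + 1 : ℝ) * (Real.pi / 2)) = (-1) ^ (k + 1) := by
      push_cast
      rw [← Real.cos_nat_mul_pi]
      congr 1
      push_cast
      ring
    rw [this]
    push_cast
    have hk : (k : ℝ) + 1 ≠ 0 := by positivity
    have hk' : 2 * (k : ℝ) + 1 + 1 ≠ 0 := by positivity
    field_simp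
    ring

/-! ### Moments of 1/sin x through the Riemann-Lebesgue lemma -/

open MeasureTheory in
/-- The Riemann-Lebesgue lemma on `[0, π / 2]`. -/
theorem riemann_lebesgue {g : ℝ → ℝ} (hg : IntervalIntegrable g volume 0 (Real.pi / 2)) :
    Tendsto (fun N : ℕ => ∫ x in (0 : ℝ)..(Real.pi / 2), g x * Real.cos (2 * N * x)) atTop (𝓝 0) ∧
    Tendsto (fun N : ℕ => ∫ x in (0 : ℝ)..(Real.pi / 2), g x * Real.sin (2 * N * x)) atTop
      (𝓝 0) := by
  have hpi := Real.pi_pos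
  let F : ℝ → ℂ := (Set.Ioc 0 (Real.pi / 2)).indicator fun x => (g x : ℂ)
  have hF : Integrable F := by
    rw [intervalIntegrable_iff_integrableOn_Ioc_of_le (by positivity)] at hg
    exact (integrable_indicator_iff measurableSet_Ioc).2 hg.ofReal
  -- The Fourier character carries a factor 2π, so the frequency N/π produces the angle 2Nx.
  have hw : Tendsto (fun N : ℕ => (N : ℝ) / Real.pi) atTop (cocompact ℝ) :=
    (tendsto_natCast_atTop_atTop.atTop_div_const hpi).mono_right atTop_le_cocompact
  have h := (Real.tendsto_integral_exp_smul_cocompact F).comp hw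
  have hint : ∀ w : ℝ, Integrable fun v : ℝ => Real.fourierChar (-(v * w)) • F v := by
    intro w
    have := (Real.fourierIntegral_convergent_iff (μ := volume) (f := F) w).2 hF
    simpa [mul_comm] using this
  have hexp : ∀ (N : ℕ) (v : ℝ), ((Real.fourierChar (-(v * ((N : ℝ) / Real.pi))) : Circle) : ℂ) =
      (Real.cos (2 * N * v) : ℂ) - (Real.sin (2 * N * v) : ℂ) * Complex.I := by
    intro N v
    rw [Real.fourierChar_apply]
    have : (↑(2 * Real.pi * -(v * ((N : ℝ) / Real.pi))) : ℂ) * Complex.I =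
        ((-(2 * N * v) : ℝ) : ℂ) * Complex.I := by
      congr 2
      field_simp
    rw [this, Complex.exp_mul_I, ← Complex.ofReal_cos, ← Complex.ofReal_sin, Real.cos_neg,
      Real.sin_neg]
    push_cast
    ring
  constructor
  · have h1 := (Complex.continuous_re.tendsto 0).comp h
    rw [Complex.zero_re] at h1
    refine h1.congr fun N => ?_
    simp only [Function.comp]
    rw [← Complex.reCLM_apply, ← ContinuousLinearMap.integral_comp_comm _ (hint _),
      intervalIntegral.integral_of_le (by positivity), ← integral_indicator measurableSet_Ioc]
    refine integral_congr_ae (Filter.Eventually.of_forall fun v => ?_)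
    simp only [Complex.reCLM_apply, Circle.smul_def, hexp, F]
    by_cases hv : v ∈ Set.Ioc 0 (Real.pi / 2)
    · simp only [Set.indicator_of_mem hv, smul_eq_mul]
      simp [-Complex.ofReal_cos, -Complex.ofReal_sin, mul_comm]
    · simp [Set.indicator_of_notMem hv]
  · have h1 := ((Complex.continuous_im.tendsto 0).comp h).neg
    rw [Complex.zero_im, neg_zero] at h1
    refine h1.congr fun N => ?_
    simp only [Function.comp]
    rw [← Complex.imCLM_apply, ← ContinuousLinearMap.integral_comp_comm _ (hint _),
      intervalIntegral.integral_of_le (by positivity), ← integral_indicator measurableSet_Ioc,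
      ← integral_neg]
    refine integral_congr_ae (Filter.Eventually.of_forall fun v => ?_)
    simp only [Complex.imCLM_apply, Circle.smul_def, hexp, F]
    by_cases hv : v ∈ Set.Ioc 0 (Real.pi / 2)
    · simp only [Set.indicator_of_mem hv, smul_eq_mul]
      simp [-Complex.ofReal_cos, -Complex.ofReal_sin, mul_comm]
    · simp [Set.indicator_of_notMem hv]

theorem sin_mul_sum_sin (N : ℕ) (x : ℝ) :
    Real.sin x * ∑ j ∈ Finset.range N, 2 * Real.sin ((2 * (j : ℝ) + 1) * x) =
      1 - Real.cos (2 * N * x) := by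
  induction N with
  | zero => simp
  | succ N ih =>
    have h1 : Real.cos (2 * (N : ℝ) * x) = Real.cos ((2 * (N : ℝ) + 1) * x) * Real.cos x +
        Real.sin ((2 * (N : ℝ) + 1) * x) * Real.sin x := by
      rw [← Real.cos_sub]
      congr 1
      ring
    have h2 : Real.cos (2 * ((N : ℝ) + 1) * x) = Real.cos ((2 * (N : ℝ) + 1) * x) * Real.cos x -
        Real.sin ((2 * (N : ℝ) + 1) * x) * Real.sin x := by
      rw [← Real.cos_add]
      congr 1
      ring
    rw [Finset.sum_range_succ, mul_add, ih, h1]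
    push_cast
    rw [h2]
    ring

theorem sin_mul_sum_cos (N : ℕ) (x : ℝ) :
    Real.sin x * ∑ j ∈ Finset.range N, 2 * Real.cos ((2 * (j : ℝ) + 1) * x) =
      Real.sin (2 * N * x) := by
  induction N with
  | zero => simp
  | succ N ih =>
    have h1 : Real.sin (2 * (N : ℝ) * x) = Real.sin ((2 * (N : ℝ) + 1) * x) * Real.cos x -
        Real.cos ((2 * (N : ℝ) + 1) * x) * Real.sin x := by
      rw [← Real.sin_sub]
      congr 1
      ring
    have h2 : Real.sin (2 * ((N : ℝ) + 1) * x) = Real.sin ((2 * (N : ℝ) + 1) * x) * Real.cos x +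
        Real.cos ((2 * (N : ℝ) + 1) * x) * Real.sin x := by
      rw [← Real.sin_add]
      congr 1
      ring
    rw [Finset.sum_range_succ, mul_add, ih, h1]
    push_cast
    rw [h2]
    ring

/-- `∫ x^m / m! sin (a x)` over `[0, π / 2]`. -/
noncomputable def sinMoment (m : ℕ) (a : ℝ) : ℝ :=
  ∫ x in (0 : ℝ)..(Real.pi / 2), x ^ m / (m.factorial : ℝ) * Real.sin (a * x)

/-- `∫ x^m / m! cos (a x)` over `[0, π / 2]`. -/
noncomputable def cosMoment (m : ℕ) (a : ℝ) : ℝ :=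
  ∫ x in (0 : ℝ)..(Real.pi / 2), x ^ m / (m.factorial : ℝ) * Real.cos (a * x)

/-- Expresses 1/sin x = 2 ∑ sin((2j+1)x) weakly: the partial sums equal (1 - cos 2Nx)/sin x, and the
oscillating part dies against an integrable function. The power x^{m+1} provides the integrability.
-/
theorem tendsto_sum_sinMoment (m : ℕ) :
    Tendsto (fun N => ∑ j ∈ Finset.range N, 2 * sinMoment (m + 1) (2 * (j : ℝ) + 1)) atTop
      (𝓝 (powIntegral (m + 1))) := by
  have hpi := Real.pi_pos
  have h := ((riemann_lebesgue (intervalIntegrable_pow m)).1.const_sub (powIntegral (m + 1)))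
  rw [sub_zero] at h
  refine h.congr fun N => ?_
  have hi : IntervalIntegrable (fun x => x ^ (m + 1) / ((m + 1).factorial : ℝ) / Real.sin x *
      Real.cos (2 * N * x)) MeasureTheory.volume 0 (Real.pi / 2) :=
    (intervalIntegrable_pow m).mul_continuousOn (by fun_prop)
  rw [powIntegral, ← intervalIntegral.integral_sub (intervalIntegrable_pow m) hi]
  simp only [sinMoment, ← intervalIntegral.integral_const_mul]
  rw [← intervalIntegral.integral_finsetSum fun j _ =>
    Continuous.intervalIntegrable (by fun_prop) _ _]
  refine intervalIntegral.integral_congr_ae (Filter.Eventually.of_forall fun x hx => ?_)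
  rw [Set.uIoc_of_le (by positivity)] at hx
  have hs := (sin_pos_of_mem hx).ne'
  have hsum := sin_mul_sum_sin N x
  rw [← mul_one_sub, ← hsum, Finset.mul_sum, Finset.mul_sum]
  refine Finset.sum_congr rfl fun j _ => ?_
  field_simp

/-- The cosine partial sums are sin(2Nx)/sin x, with no main term, so the limit is a relation rather
than an evaluation. -/
theorem tendsto_sum_cosMoment (m : ℕ) :
    Tendsto (fun N => ∑ j ∈ Finset.range N, 2 * cosMoment (m + 1) (2 * (j : ℝ) + 1)) atTop
      (𝓝 0) := by
  have hpi := Real.pi_pos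
  refine (riemann_lebesgue (intervalIntegrable_pow m)).2.congr fun N => ?_
  simp only [cosMoment, ← intervalIntegral.integral_const_mul]
  rw [← intervalIntegral.integral_finsetSum fun j _ =>
    Continuous.intervalIntegrable (by fun_prop) _ _]
  refine intervalIntegral.integral_congr_ae (Filter.Eventually.of_forall fun x hx => ?_)
  rw [Set.uIoc_of_le (by positivity)] at hx
  have hs := (sin_pos_of_mem hx).ne'
  rw [← sin_mul_sum_cos N x, Finset.mul_sum, Finset.mul_sum]
  refine Finset.sum_congr rfl fun j _ => ?_
  field_simp

theorem sin_odd_mul_half_pi (j : ℕ) : Real.sin ((2 * (j : ℝ) + 1) * (Real.pi / 2)) = (-1) ^ j := by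
  rw [show (2 * (j : ℝ) + 1) * (Real.pi / 2) = j * Real.pi + Real.pi / 2 by ring,
    Real.sin_add_pi_div_two, Real.cos_nat_mul_pi]

theorem cos_odd_mul_half_pi (j : ℕ) : Real.cos ((2 * (j : ℝ) + 1) * (Real.pi / 2)) = 0 := by
  rw [show (2 * (j : ℝ) + 1) * (Real.pi / 2) = j * Real.pi + Real.pi / 2 by ring,
    Real.cos_add_pi_div_two, Real.sin_nat_mul_pi, neg_zero]

theorem hasDerivAt_pow_div_factorial (m : ℕ) (x : ℝ) :
    HasDerivAt (fun x : ℝ => x ^ (m + 1) / ((m + 1).factorial : ℝ)) (x ^ m / (m.factorial : ℝ))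
      x := by
  refine ((hasDerivAt_pow (m + 1) x).div_const _).congr_deriv ?_
  rw [Nat.factorial_succ, Nat.add_sub_cancel]
  have : (m.factorial : ℝ) ≠ 0 := by positivity
  have h2 : (m : ℝ) + 1 ≠ 0 := by positivity
  push_cast
  field_simp

theorem sinMoment_zero (j : ℕ) : sinMoment 0 (2 * (j : ℝ) + 1) = 1 / (2 * (j : ℝ) + 1) := by
  have ha : 2 * (j : ℝ) + 1 ≠ 0 := by positivity
  simp only [sinMoment, pow_zero, Nat.factorial_zero, Nat.cast_one, div_one, one_mul]
  rw [intervalIntegral.integral_comp_mul_left (fun x => Real.sin x) ha, integral_sin,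
    cos_odd_mul_half_pi]
  simp

theorem sinMoment_add_two (m j : ℕ) : sinMoment (m + 2) (2 * (j : ℝ) + 1) =
    (Real.pi / 2) ^ (m + 1) / ((m + 1).factorial : ℝ) * (-1) ^ j / (2 * (j : ℝ) + 1) ^ 2
      - sinMoment m (2 * (j : ℝ) + 1) / (2 * (j : ℝ) + 1) ^ 2 := by
  set a : ℝ := 2 * (j : ℝ) + 1 with ha
  have ha0 : a ≠ 0 := by positivity
  have hlin : ∀ x : ℝ, HasDerivAt (fun x : ℝ => a * x) a x := fun x => by
    simpa using (hasDerivAt_id x).const_mul a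
  have h := intervalIntegral.integral_eq_sub_of_hasDerivAt (a := 0) (b := Real.pi / 2)
    (f := fun x => x ^ (m + 1) / ((m + 1).factorial : ℝ) * (Real.sin (a * x) / a ^ 2) -
      x ^ (m + 2) / ((m + 2).factorial : ℝ) * (Real.cos (a * x) / a))
    (f' := fun x => x ^ (m + 2) / ((m + 2).factorial : ℝ) * Real.sin (a * x) +
      x ^ m / (m.factorial : ℝ) * Real.sin (a * x) / a ^ 2) (fun x _ => ?_)
    (Continuous.intervalIntegrable (by fun_prop) _ _)
  · rw [intervalIntegral.integral_add (Continuous.intervalIntegrable (by fun_prop) _ _)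
      (Continuous.intervalIntegrable (by fun_prop) _ _), intervalIntegral.integral_div,
      ha, cos_odd_mul_half_pi, sin_odd_mul_half_pi, ← ha] at h
    simp only [sinMoment]
    rw [eq_sub_iff_add_eq, h]
    simp
    ring
  · refine (((hasDerivAt_pow_div_factorial m x).mul ((hlin x).sin.div_const (a ^ 2))).sub
      ((hasDerivAt_pow_div_factorial (m + 1) x).mul ((hlin x).cos.div_const a))).congr_deriv ?_
    field_simp
    ring

theorem cosMoment_one (j : ℕ) : cosMoment 1 (2 * (j : ℝ) + 1) =
    Real.pi / 2 * (-1) ^ j / (2 * (j : ℝ) + 1) - 1 / (2 * (j : ℝ) + 1) ^ 2 := by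
  set a : ℝ := 2 * (j : ℝ) + 1 with ha
  have ha0 : a ≠ 0 := by positivity
  have hlin : ∀ x : ℝ, HasDerivAt (fun x : ℝ => a * x) a x := fun x => by
    simpa using (hasDerivAt_id x).const_mul a
  have h := intervalIntegral.integral_eq_sub_of_hasDerivAt (a := 0) (b := Real.pi / 2)
    (f := fun x => x * (Real.sin (a * x) / a) + Real.cos (a * x) / a ^ 2)
    (f' := fun x => x ^ 1 / ((1 : ℕ).factorial : ℝ) * Real.cos (a * x)) (fun x _ => ?_)
    (Continuous.intervalIntegrable (by fun_prop) _ _)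
  · rw [ha, cos_odd_mul_half_pi, sin_odd_mul_half_pi, ← ha] at h
    rw [cosMoment, h]
    simp
    ring
  · refine (((hasDerivAt_id x).mul ((hlin x).sin.div_const a)).add
      ((hlin x).cos.div_const (a ^ 2))).congr_deriv ?_
    simp
    field_simp
    ring

theorem cosMoment_add_two (m j : ℕ) : cosMoment (m + 2) (2 * (j : ℝ) + 1) =
    (Real.pi / 2) ^ (m + 2) / ((m + 2).factorial : ℝ) * (-1) ^ j / (2 * (j : ℝ) + 1)
      - cosMoment m (2 * (j : ℝ) + 1) / (2 * (j : ℝ) + 1) ^ 2 := by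
  set a : ℝ := 2 * (j : ℝ) + 1 with ha
  have ha0 : a ≠ 0 := by positivity
  have hlin : ∀ x : ℝ, HasDerivAt (fun x : ℝ => a * x) a x := fun x => by
    simpa using (hasDerivAt_id x).const_mul a
  have h := intervalIntegral.integral_eq_sub_of_hasDerivAt (a := 0) (b := Real.pi / 2)
    (f := fun x => x ^ (m + 2) / ((m + 2).factorial : ℝ) * (Real.sin (a * x) / a) +
      x ^ (m + 1) / ((m + 1).factorial : ℝ) * (Real.cos (a * x) / a ^ 2))
    (f' := fun x => x ^ (m + 2) / ((m + 2).factorial : ℝ) * Real.cos (a * x) +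
      x ^ m / (m.factorial : ℝ) * Real.cos (a * x) / a ^ 2) (fun x _ => ?_)
    (Continuous.intervalIntegrable (by fun_prop) _ _)
  · rw [intervalIntegral.integral_add (Continuous.intervalIntegrable (by fun_prop) _ _)
      (Continuous.intervalIntegrable (by fun_prop) _ _), intervalIntegral.integral_div,
      ha, cos_odd_mul_half_pi, sin_odd_mul_half_pi, ← ha] at h
    simp only [cosMoment]
    rw [eq_sub_iff_add_eq, h]
    simp
    ring
  · refine (((hasDerivAt_pow_div_factorial (m + 1) x).mul ((hlin x).sin.div_const a)).add
      ((hasDerivAt_pow_div_factorial m x).mul ((hlin x).cos.div_const (a ^ 2)))).congr_deriv ?_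
    field_simp
    ring

/-- The coefficient `(-1)^k / (2k+1)! (π / 2)^(2k+1)` of the sine series. -/
noncomputable def sinCoeff (k : ℕ) : ℝ :=
  (-1) ^ k / ((2 * k + 1).factorial : ℝ) * (Real.pi / 2) ^ (2 * k + 1)

/-- Repeated integration by parts. At π/2 the cosine of an odd multiple vanishes and the sine is
(-1)^j, so the boundary terms become beta summands when summed over j, while the initial integral
gives the λ summand. -/
theorem sinMoment_even (i j : ℕ) : (-1) ^ i * sinMoment (2 * i) (2 * (j : ℝ) + 1) =
    1 / (2 * (j : ℝ) + 1) ^ (2 * i + 1) -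
      ∑ k ∈ Finset.range i, sinCoeff k * ((-1) ^ j / (2 * (j : ℝ) + 1) ^ (2 * (i - k))) := by
  have ha0 : 2 * (j : ℝ) + 1 ≠ 0 := by positivity
  induction i with
  | zero => simp [sinMoment_zero]
  | succ i ih =>
    have e : ∑ k ∈ Finset.range i, sinCoeff k *
          ((-1) ^ j / (2 * (j : ℝ) + 1) ^ (2 * (i + 1 - k))) =
        (∑ k ∈ Finset.range i, sinCoeff k * ((-1) ^ j / (2 * (j : ℝ) + 1) ^ (2 * (i - k)))) /
          (2 * (j : ℝ) + 1) ^ 2 := by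
      rw [Finset.sum_div]
      refine Finset.sum_congr rfl fun k hk => ?_
      rw [Finset.mem_range] at hk
      rw [mul_div_assoc, div_div, ← pow_add]
      congr 3
      omega
    rw [Finset.sum_range_succ, e, show 2 * (i + 1) = 2 * i + 2 by ring, sinMoment_add_two,
      show 2 * (i + 1 - i) = 2 by omega, show 2 * i + 2 + 1 = 2 * i + 1 + 2 by ring,
      pow_add _ (2 * i + 1) 2, ← div_div, sinCoeff, pow_succ (-1 : ℝ) i]
    linear_combination (1 / (2 * (j : ℝ) + 1) ^ 2) * ih

theorem cosMoment_odd (m j : ℕ) : (-1) ^ m * cosMoment (2 * m + 1) (2 * (j : ℝ) + 1) =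
    ∑ k ∈ Finset.range (m + 1), sinCoeff k * ((-1) ^ j / (2 * (j : ℝ) + 1) ^ (2 * (m - k) + 1))
      - 1 / (2 * (j : ℝ) + 1) ^ (2 * m + 2) := by
  have ha0 : 2 * (j : ℝ) + 1 ≠ 0 := by positivity
  induction m with
  | zero =>
    simp [cosMoment_one, sinCoeff]
    ring
  | succ m ih =>
    have e : ∑ k ∈ Finset.range (m + 1), sinCoeff k *
          ((-1) ^ j / (2 * (j : ℝ) + 1) ^ (2 * (m + 1 - k) + 1)) =
        (∑ k ∈ Finset.range (m + 1), sinCoeff k *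
          ((-1) ^ j / (2 * (j : ℝ) + 1) ^ (2 * (m - k) + 1))) / (2 * (j : ℝ) + 1) ^ 2 := by
      rw [Finset.sum_div]
      refine Finset.sum_congr rfl fun k hk => ?_
      rw [Finset.mem_range] at hk
      rw [mul_div_assoc, div_div, ← pow_add]
      congr 3
      omega
    rw [Finset.sum_range_succ, e, show 2 * (m + 1) + 1 = 2 * m + 1 + 2 by ring, cosMoment_add_two,
      show 2 * (m + 1 - (m + 1)) + 1 = 1 by omega, show 2 * (m + 1) + 2 = 2 * m + 2 + 2 by ring,
      pow_add _ (2 * m + 2) 2, ← div_div, sinCoeff, pow_succ (-1 : ℝ) m,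
      show 2 * (m + 1) + 1 = 2 * m + 1 + 2 by ring]
    linear_combination (1 / (2 * (j : ℝ) + 1) ^ 2) * ih

/-! ### Lambda and eta values, harmonic sums -/

/-- The value at `s` of `∑ 1 / (2n+1)^s`, for `s ≥ 2`. -/
noncomputable def lamVal (s : ℕ) : ℝ := (1 - (1 / 2) ^ s) * zetaVal s

/-- The value at `s ≥ 1` of the Dirichlet eta function. -/
noncomputable def etaVal (s : ℕ) : ℝ :=
  if s = 1 then Real.log 2 else (1 - 2 * (1 / 2) ^ s) * zetaVal s

theorem hasSum_of_eq {f g : ℕ → ℝ} {a : ℝ} (h : ∀ k, f k = g k) (hg : HasSum g a) :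
    HasSum f a := by
  rwa [funext h]

theorem hasSum_zetaVal {s : ℕ} (hs : 2 ≤ s) :
    HasSum (fun n : ℕ => 1 / ((n : ℝ) + 1) ^ s) (zetaVal s) := by
  have h : zetaVal s = ∑' n : ℕ, 1 / (n : ℝ) ^ s := by
    have h : riemannZeta s = ((∑' n : ℕ, 1 / (n : ℝ) ^ s : ℝ) : ℂ) := by
      rw [zeta_nat_eq_tsum_of_gt_one (by omega)]
      push_cast
      rfl
    rw [zetaVal, h, Complex.ofReal_re]
  have h1 := (Real.summable_one_div_nat_pow.2 (by omega : 1 < s)).hasSum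
  rw [← h, ← hasSum_nat_add_iff' 1] at h1
  simpa [show s ≠ 0 by omega] using h1

theorem hasSum_lamVal {s : ℕ} (hs : 2 ≤ s) :
    HasSum (fun j : ℕ => 1 / (2 * (j : ℝ) + 1) ^ s) (lamVal s) := by
  have hz := hasSum_zetaVal hs
  have hodd : HasSum (fun k : ℕ => 1 / (((2 * k + 1 : ℕ) : ℝ) + 1) ^ s)
      ((1 / 2) ^ s * zetaVal s) := by
    refine hasSum_of_eq (fun k => ?_) (hz.mul_left ((1 / 2) ^ s))
    push_cast
    rw [show 2 * (k : ℝ) + 1 + 1 = 2 * (k + 1) by ring, mul_pow, one_div_pow]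
    field_simp
  have heven : Summable (fun k : ℕ => 1 / (((2 * k : ℕ) : ℝ) + 1) ^ s) :=
    hz.summable.comp_injective (i := fun k : ℕ => 2 * k) fun a b h => by
      simpa using h
  have h := HasSum.even_add_odd (f := fun n : ℕ => 1 / ((n : ℝ) + 1) ^ s) heven.hasSum hodd
  have e := h.unique hz
  have e2 : ∑' k : ℕ, 1 / (((2 * k : ℕ) : ℝ) + 1) ^ s = lamVal s := by
    rw [lamVal]
    linarith
  have h3 := heven.hasSum
  rw [e2] at h3
  simpa using h3

theorem hasSum_etaVal {s : ℕ} (hs : 2 ≤ s) :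
    HasSum (fun n : ℕ => (-1) ^ n / ((n : ℝ) + 1) ^ s) (etaVal s) := by
  have h1 : HasSum (fun k : ℕ => (-1) ^ (2 * k) / (((2 * k : ℕ) : ℝ) + 1) ^ s) (lamVal s) := by
    refine hasSum_of_eq (fun k => ?_) (hasSum_lamVal hs)
    rw [pow_mul]
    simp
  have h2 : HasSum (fun k : ℕ => (-1) ^ (2 * k + 1) / (((2 * k + 1 : ℕ) : ℝ) + 1) ^ s)
      (-((1 / 2) ^ s * zetaVal s)) := by
    refine hasSum_of_eq (fun k => ?_) (((hasSum_zetaVal hs).mul_left ((1 / 2) ^ s)).neg)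
    push_cast
    rw [show 2 * (k : ℝ) + 1 + 1 = 2 * (k + 1) by ring, mul_pow, one_div_pow, pow_succ, pow_mul]
    norm_num
    field_simp
  have h := HasSum.even_add_odd (f := fun n : ℕ => (-1) ^ n / ((n : ℝ) + 1) ^ s) h1 h2
  have e : lamVal s + -((1 / 2) ^ s * zetaVal s) = etaVal s := by
    rw [lamVal, etaVal, if_neg (by omega)]
    ring
  rwa [e] at h

/-- Alternating harmonic sums. -/
noncomputable def altHarm (M : ℕ) : ℝ := ∑ m ∈ Finset.Icc 1 M, (-1) ^ m / (m : ℝ)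

/-- Harmonic sums. -/
noncomputable def harm (M : ℕ) : ℝ := ∑ m ∈ Finset.Icc 1 M, 1 / (m : ℝ)

/-- Sums of reciprocals of odd numbers. -/
noncomputable def oddHarm (M : ℕ) : ℝ := ∑ i ∈ Finset.range M, 1 / (2 * (i : ℝ) + 1)

theorem altHarm_succ (M : ℕ) : altHarm (M + 1) = altHarm M + (-1) ^ (M + 1) / ((M : ℝ) + 1) := by
  rw [altHarm, Finset.sum_Icc_succ_top (by omega), ← altHarm]
  push_cast
  rfl

theorem harm_succ (M : ℕ) : harm (M + 1) = harm M + 1 / ((M : ℝ) + 1) := by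
  rw [harm, Finset.sum_Icc_succ_top (by omega), ← harm]
  push_cast
  rfl

theorem oddHarm_succ (M : ℕ) : oddHarm (M + 1) = oddHarm M + 1 / (2 * (M : ℝ) + 1) := by
  rw [oddHarm, Finset.sum_range_succ, ← oddHarm]

theorem harm_two_mul (k : ℕ) : harm (2 * k) = oddHarm k + harm k / 2 := by
  induction k with
  | zero => simp [harm, oddHarm]
  | succ k ih =>
    rw [show 2 * (k + 1) = 2 * k + 1 + 1 by ring, harm_succ, harm_succ, ih, oddHarm_succ, harm_succ]
    push_cast
    field_simp
    ring

theorem altHarm_two_mul (k : ℕ) : altHarm (2 * k) = harm k / 2 - oddHarm k := by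
  induction k with
  | zero => simp [harm, oddHarm, altHarm]
  | succ k ih =>
    rw [show 2 * (k + 1) = 2 * k + 1 + 1 by ring, altHarm_succ, altHarm_succ, ih, oddHarm_succ,
      harm_succ, pow_succ _ (2 * k + 1), pow_succ _ (2 * k), pow_mul]
    push_cast
    norm_num
    field_simp
    ring

theorem harm_eq_harmonic (n : ℕ) : harm n = (harmonic n : ℝ) := by
  rw [harm, sum_Icc_one_eq, harmonic]
  push_cast
  simp

/-- Leibniz' criterion gives a limit; the even-indexed terms are H_k - H_{2k}, in which Euler's
constant cancels and -log 2 remains. -/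
theorem tendsto_altHarm : Tendsto altHarm atTop (𝓝 (-Real.log 2)) := by
  have hanti : Antitone fun n : ℕ => 1 / ((n : ℝ) + 1) := by
    intro a b hab
    have h : (a : ℝ) ≤ b := by exact_mod_cast hab
    dsimp only
    gcongr
  obtain ⟨l, hl⟩ := hanti.tendsto_alternating_series_of_tendsto_zero
    tendsto_one_div_add_atTop_nhds_zero_nat
  have hl' : Tendsto altHarm atTop (𝓝 (-l)) := by
    refine hl.neg.congr fun N => ?_
    rw [altHarm, sum_Icc_one_eq, ← Finset.sum_neg_distrib]
    refine Finset.sum_congr rfl fun n _ => ?_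
    rw [pow_succ]
    push_cast
    ring
  have h2 : Tendsto (fun k : ℕ => 2 * k) atTop atTop :=
    tendsto_atTop_mono (fun k => by simp only [id]; omega) tendsto_id
  have hsub := hl'.comp h2
  have hγ := Real.tendsto_harmonic_sub_log
  have h3 := (hγ.sub (hγ.comp h2)).sub_const (Real.log 2)
  rw [sub_self, zero_sub] at h3
  have h4 : Tendsto (altHarm ∘ fun k : ℕ => 2 * k) atTop (𝓝 (-Real.log 2)) := by
    refine h3.congr' ?_
    filter_upwards [eventually_ge_atTop 1] with k hk
    have hk' : (k : ℝ) ≠ 0 := by positivity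
    have e1 := harm_two_mul k
    simp only [Function.comp]
    rw [altHarm_two_mul, ← harm_eq_harmonic, ← harm_eq_harmonic, e1]
    push_cast
    rw [Real.log_mul two_ne_zero hk']
    ring
  rwa [tendsto_nhds_unique hsub h4] at hl'

/-- Partial sums of the eta function. -/
noncomputable def etaTrunc (s N : ℕ) : ℝ := ∑ n ∈ Finset.range N, (-1) ^ n / ((n : ℝ) + 1) ^ s

theorem sum_alternating_eq_neg_etaTrunc (s N : ℕ) :
    ∑ n ∈ Finset.Icc 1 N, (-1) ^ n / (n : ℝ) ^ s = -etaTrunc s N := by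
  rw [etaTrunc, sum_Icc_one_eq, ← Finset.sum_neg_distrib]
  refine Finset.sum_congr rfl fun n _ => ?_
  rw [pow_succ]
  push_cast
  ring

theorem tendsto_etaTrunc {s : ℕ} (hs : 1 ≤ s) : Tendsto (etaTrunc s) atTop (𝓝 (etaVal s)) := by
  rcases hs.eq_or_lt with rfl | hs
  · have h := tendsto_altHarm.neg
    rw [neg_neg] at h
    rw [etaVal, if_pos rfl]
    refine h.congr fun N => ?_
    have := sum_alternating_eq_neg_etaTrunc 1 N
    simp only [pow_one] at this
    rw [altHarm, this, neg_neg]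
  · exact (hasSum_etaVal hs).tendsto_sum_nat

theorem tendsto_lamTrunc {s : ℕ} (hs : 2 ≤ s) :
    Tendsto (fun N => ∑ j ∈ Finset.range N, 1 / (2 * (j : ℝ) + 1) ^ s) atTop (𝓝 (lamVal s)) :=
  (hasSum_lamVal hs).tendsto_sum_nat

theorem sum_altHarm_shift (K N : ℕ) :
    ∑ j ∈ Finset.range N, (-1) ^ (j + K + 1) / ((j : ℝ) + K + 1) = altHarm (K + N) - altHarm K := by
  induction N with
  | zero => simp
  | succ N ih =>
    rw [Finset.sum_range_succ, ih, ← add_assoc, altHarm_succ]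
    push_cast
    rw [add_comm N K, add_comm (N : ℝ) K]
    ring

/-! ### Convolutions by partial fractions -/

/-- A partial fraction expansion. -/
theorem sum_antidiagonal_partial_fractions (ℓ : ℕ) {a b : ℝ} (ha : 0 < a) (hb : 0 < b) :
    ∑ x ∈ Finset.HasAntidiagonal.antidiagonal (2 * ℓ),
      (-1) ^ x.1 * (1 / a ^ (x.1 + 1)) * (1 / b ^ (x.2 + 1)) =
      (1 / a ^ (2 * ℓ + 1) + 1 / b ^ (2 * ℓ + 1)) / (a + b) := by
  have h := Commute.geom_sum₂_mul (Commute.all (-(1 / a)) (1 / b)) (2 * ℓ + 1)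
  rw [Finset.Nat.sum_antidiagonal_eq_sum_range_succ_mk]
  have e : ∑ k ∈ Finset.range (2 * ℓ).succ,
      (-1) ^ k * (1 / a ^ (k + 1)) * (1 / b ^ (2 * ℓ - k + 1)) =
      (1 / a * (1 / b)) * ∑ i ∈ Finset.range (2 * ℓ + 1),
        (-(1 / a)) ^ i * (1 / b) ^ (2 * ℓ + 1 - 1 - i) := by
    rw [Finset.mul_sum]
    refine Finset.sum_congr rfl fun k _ => ?_
    rw [neg_pow (1 / a), Nat.add_sub_cancel, one_div_pow, one_div_pow, pow_succ, pow_succ]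
    field_simp
  rw [e, eq_div_iff (by positivity)]
  -- The exponent is odd, so the difference of powers in the geometric sum becomes a sum, symmetric
  -- in a and b.
  have h2 : (-(1 / a)) ^ (2 * ℓ + 1) = -(1 / a ^ (2 * ℓ + 1)) := by
    rw [Odd.neg_pow ⟨ℓ, rfl⟩, one_div_pow]
  rw [h2, one_div_pow] at h
  have h3 : 1 / a * (1 / b) * (a + b) = 1 / a + 1 / b := by field_simp; ring
  linear_combination -h + (∑ i ∈ Finset.range (2 * ℓ + 1),
        (-(1 / a)) ^ i * (1 / b) ^ (2 * ℓ + 1 - 1 - i)) * h3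

/-- The two partial fraction terms are exchanged by swapping j and k, hence the factor 2. Staying at
finite N keeps the rearrangement legitimate when η(1) or β(1) converges only conditionally. -/
theorem sum_antidiagonal_mul (ℓ N : ℕ) (w a : ℕ → ℝ) (ha : ∀ j, 0 < a j) :
    ∑ x ∈ Finset.HasAntidiagonal.antidiagonal (2 * ℓ),
      (-1) ^ x.1 * (∑ j ∈ Finset.range N, w j / a j ^ (x.1 + 1)) *
        (∑ k ∈ Finset.range N, w k / a k ^ (x.2 + 1)) =
      2 * ∑ k ∈ Finset.range N, 1 / a k ^ (2 * ℓ + 1) *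
        ∑ j ∈ Finset.range N, w j * w k / (a j + a k) := by
  have h1 : ∀ x : ℕ × ℕ, (-1) ^ x.1 * (∑ j ∈ Finset.range N, w j / a j ^ (x.1 + 1)) *
        (∑ k ∈ Finset.range N, w k / a k ^ (x.2 + 1)) =
      ∑ j ∈ Finset.range N, ∑ k ∈ Finset.range N, w j * w k *
        ((-1) ^ x.1 * (1 / a j ^ (x.1 + 1)) * (1 / a k ^ (x.2 + 1))) := by
    intro x
    rw [mul_assoc, Finset.sum_mul_sum, Finset.mul_sum]
    refine Finset.sum_congr rfl fun j _ => ?_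
    rw [Finset.mul_sum]
    refine Finset.sum_congr rfl fun k _ => ?_
    ring
  simp only [h1]
  rw [Finset.sum_comm]
  have h2 : ∀ j ∈ Finset.range N, ∑ x ∈ Finset.HasAntidiagonal.antidiagonal (2 * ℓ),
      ∑ k ∈ Finset.range N, w j * w k *
        ((-1) ^ x.1 * (1 / a j ^ (x.1 + 1)) * (1 / a k ^ (x.2 + 1))) =
      ∑ k ∈ Finset.range N, (1 / a j ^ (2 * ℓ + 1) * (w j * w k / (a j + a k)) +
        1 / a k ^ (2 * ℓ + 1) * (w j * w k / (a j + a k))) := by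
    intro j _
    rw [Finset.sum_comm]
    refine Finset.sum_congr rfl fun k _ => ?_
    rw [← Finset.mul_sum, sum_antidiagonal_partial_fractions ℓ (ha j) (ha k)]
    ring
  rw [Finset.sum_congr rfl h2]
  simp only [Finset.sum_add_distrib]
  refine Eq.trans (congrArg₂ (· + ·) ?_ ?_) (two_mul _).symm
  · refine Finset.sum_congr rfl fun j _ => ?_
    rw [Finset.mul_sum]
    refine Finset.sum_congr rfl fun k _ => ?_
    rw [mul_comm (w j), add_comm (a j)]
  · rw [Finset.sum_comm]
    refine Finset.sum_congr rfl fun j _ => ?_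
    rw [Finset.mul_sum]

/-- The inner sum over j < N is a window of an alternating series, starting at k. Dominated
convergence replaces it by the tail, since convergent partial sums are bounded. -/
theorem tendsto_sum_mul_shift_sub {A b : ℕ → ℝ} {L : ℝ} (hA : Tendsto A atTop (𝓝 L))
    (hb : Summable b) (hb0 : ∀ k, 0 ≤ b k) :
    Tendsto (fun N => ∑ k ∈ Finset.range N, b k * (A (k + N) - A k)) atTop
      (𝓝 (∑' k, b k * (L - A k))) := by
  have hbd : ∃ B, ∀ k, |A k| ≤ B := by
    obtain ⟨B, hB⟩ := (Metric.isBounded_range_of_tendsto A hA).exists_norm_le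
    exact ⟨B, fun k => hB _ ⟨k, rfl⟩⟩
  obtain ⟨B, hB⟩ := hbd
  have h := tendsto_tsum_of_dominated_convergence (𝓕 := atTop)
    (f := fun N k => if k < N then b k * (A (k + N) - A k) else 0)
    (g := fun k => b k * (L - A k)) (bound := fun k => b k * (2 * B)) (hb.mul_right _)
    (fun k => ?_) (Filter.Eventually.of_forall fun N k => ?_)
  · refine h.congr fun N => ?_
    rw [tsum_eq_sum (s := Finset.range N)]
    · refine Finset.sum_congr rfl fun k hk => ?_
      rw [if_pos (Finset.mem_range.1 hk)]
    · intro k hk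
      rw [if_neg (by simpa using hk)]
  · have h1 : Tendsto (fun N => b k * (A (k + N) - A k)) atTop (𝓝 (b k * (L - A k))) := by
      refine ((hA.comp ?_).sub_const _).const_mul _
      exact tendsto_atTop_mono (fun N => by simp only [id]; omega) tendsto_id
    refine h1.congr' ?_
    filter_upwards [eventually_gt_atTop k] with N hN
    rw [if_pos hN]
  · split_ifs
    · rw [norm_mul, Real.norm_of_nonneg (hb0 k)]
      refine mul_le_mul_of_nonneg_left ?_ (hb0 k)
      rw [Real.norm_eq_abs]
      refine (abs_sub _ _).trans ?_
      linarith [hB k, hB (k + N)]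
    · rw [norm_zero]
      exact mul_nonneg (hb0 k) (by linarith [(abs_nonneg _).trans (hB 0)])

theorem sum_etaVal_mul_etaVal {ℓ : ℕ} (hℓ : 1 ≤ ℓ) :
    ∑ x ∈ Finset.HasAntidiagonal.antidiagonal (2 * ℓ),
      (-1) ^ x.1 * etaVal (x.1 + 1) * etaVal (x.2 + 1) =
      2 * ∑' k : ℕ, 1 / ((k : ℝ) + 1) ^ (2 * ℓ + 1) * (-Real.log 2 - altHarm (k + 1)) := by
  have h1 : Tendsto (fun N => ∑ x ∈ Finset.HasAntidiagonal.antidiagonal (2 * ℓ),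
      (-1) ^ x.1 * etaTrunc (x.1 + 1) N * etaTrunc (x.2 + 1) N) atTop
      (𝓝 (∑ x ∈ Finset.HasAntidiagonal.antidiagonal (2 * ℓ),
      (-1) ^ x.1 * etaVal (x.1 + 1) * etaVal (x.2 + 1))) :=
    tendsto_finsetSum _ fun x _ => ((tendsto_etaTrunc (by omega)).const_mul _).mul
      (tendsto_etaTrunc (by omega))
  have h2 := (tendsto_sum_mul_shift_sub (A := fun k => altHarm (k + 1))
    (b := fun k : ℕ => 1 / ((k : ℝ) + 1) ^ (2 * ℓ + 1))
    (tendsto_altHarm.comp (tendsto_add_atTop_nat 1))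
    (hasSum_zetaVal (by omega)).summable (fun k => by positivity)).const_mul 2
  refine tendsto_nhds_unique h1 (h2.congr fun N => ?_)
  simp only [etaTrunc]
  rw [sum_antidiagonal_mul ℓ N (fun j => (-1) ^ j) (fun j => (j : ℝ) + 1) (fun j => by positivity)]
  congr 1
  refine Finset.sum_congr rfl fun k _ => ?_
  rw [show k + N + 1 = (k + 1) + N by ring, ← sum_altHarm_shift]
  congr 1
  refine Finset.sum_congr rfl fun j _ => ?_
  push_cast
  rw [show j + (k + 1) + 1 = j + k + 2 by ring, pow_add _ (j + k), pow_add _ j,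
    show (j : ℝ) + 1 + (k + 1) = j + (k + 1) + 1 by ring]
  norm_num

/-- Two odd denominators add up to 2(j+k+1), so the inner sum is again a window of the alternating
harmonic series. The 1/2 cancels the symmetry factor, and the sign comes from shifting the exponent
by one. -/
theorem sum_betaVal_mul_betaVal {ℓ : ℕ} (hℓ : 1 ≤ ℓ) :
    ∑ x ∈ Finset.HasAntidiagonal.antidiagonal (2 * ℓ),
      (-1) ^ x.1 * betaVal (x.1 + 1) * betaVal (x.2 + 1) =
      -∑' k : ℕ, 1 / (2 * (k : ℝ) + 1) ^ (2 * ℓ + 1) * (-Real.log 2 - altHarm k) := by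
  have h1 : Tendsto (fun N => ∑ x ∈ Finset.HasAntidiagonal.antidiagonal (2 * ℓ),
      (-1) ^ x.1 * betaTrunc (x.1 + 1) N * betaTrunc (x.2 + 1) N) atTop
      (𝓝 (∑ x ∈ Finset.HasAntidiagonal.antidiagonal (2 * ℓ),
      (-1) ^ x.1 * betaVal (x.1 + 1) * betaVal (x.2 + 1))) :=
    tendsto_finsetSum _ fun x _ => ((betaTrunc_tendsto (by omega)).const_mul _).mul
      (betaTrunc_tendsto (by omega))
  have h2 := (tendsto_sum_mul_shift_sub (A := altHarm)
    (b := fun k : ℕ => 1 / (2 * (k : ℝ) + 1) ^ (2 * ℓ + 1)) tendsto_altHarm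
    (hasSum_lamVal (by omega)).summable (fun k => by positivity)).neg
  refine tendsto_nhds_unique h1 (h2.congr fun N => ?_)
  simp only [betaTrunc]
  rw [sum_antidiagonal_mul ℓ N (fun j => (-1) ^ j) (fun j => 2 * (j : ℝ) + 1)
    (fun j => by positivity), Finset.mul_sum, ← Finset.sum_neg_distrib]
  refine Finset.sum_congr rfl fun k _ => ?_
  rw [← sum_altHarm_shift, Finset.mul_sum, Finset.mul_sum, Finset.mul_sum,
    ← Finset.sum_neg_distrib]
  refine Finset.sum_congr rfl fun j _ => ?_
  rw [pow_succ (-1 : ℝ) (j + k),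
    pow_add (-1 : ℝ) j k,
    show 2 * (j : ℝ) + 1 + (2 * k + 1) = 2 * (j + k + 1) by ring]
  field_simp

/-! ### Evaluation of the moments, and a relation for λ at even arguments -/

theorem neg_one_pow_mul_powIntegral (i : ℕ) : (-1) ^ (i + 1) * powIntegral (2 * i + 2) =
    2 * lamVal (2 * i + 3) -
      2 * ∑ k ∈ Finset.range (i + 1), sinCoeff k * betaVal (2 * (i + 1 - k)) := by
  have h1 := (tendsto_sum_sinMoment (2 * i + 1)).const_mul ((-1) ^ (i + 1))
  have h2 : Tendsto (fun N => 2 * ∑ j ∈ Finset.range N, 1 / (2 * (j : ℝ) + 1) ^ (2 * i + 3) -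
      2 * ∑ k ∈ Finset.range (i + 1), sinCoeff k * betaTrunc (2 * (i + 1 - k)) N) atTop
      (𝓝 (2 * lamVal (2 * i + 3) -
      2 * ∑ k ∈ Finset.range (i + 1), sinCoeff k * betaVal (2 * (i + 1 - k)))) := by
    refine ((tendsto_lamTrunc (by omega)).const_mul 2).sub
      ((tendsto_finsetSum _ fun k hk => ?_).const_mul 2)
    rw [Finset.mem_range] at hk
    exact (betaTrunc_tendsto (by omega)).const_mul _
  refine tendsto_nhds_unique h1 (h2.congr fun N => ?_)
  simp only [betaTrunc]
  simp only [Finset.mul_sum]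
  rw [Finset.sum_comm, ← Finset.sum_sub_distrib]
  refine Finset.sum_congr rfl fun j _ => ?_
  have := sinMoment_even (i + 1) j
  rw [show 2 * (i + 1) = 2 * i + 1 + 1 by ring, show 2 * i + 1 + 1 + 1 = 2 * i + 3 by ring] at this
  rw [← Finset.mul_sum]
  linear_combination (-2) * this

/-- The vanishing limit of the cosine moments, written out. It removes even λ values from the final
formula and determines the odd beta values recursively. -/
theorem lamVal_even (m : ℕ) : lamVal (2 * m + 2) =
    ∑ k ∈ Finset.range (m + 1), sinCoeff k * betaVal (2 * (m - k) + 1) := by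
  have h1 := (tendsto_sum_cosMoment (2 * m)).const_mul ((-1) ^ m)
  rw [mul_zero] at h1
  have h2 : Tendsto (fun N => 2 * ∑ k ∈ Finset.range (m + 1), sinCoeff k *
      betaTrunc (2 * (m - k) + 1) N - 2 * ∑ j ∈ Finset.range N, 1 / (2 * (j : ℝ) + 1) ^ (2 * m + 2))
      atTop (𝓝 (2 * ∑ k ∈ Finset.range (m + 1), sinCoeff k * betaVal (2 * (m - k) + 1) -
        2 * lamVal (2 * m + 2))) := by
    refine ((tendsto_finsetSum _ fun k _ => ?_).const_mul 2).sub
      ((tendsto_lamTrunc (by omega)).const_mul 2)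
    exact (betaTrunc_tendsto (by omega)).const_mul _
  have h3 := tendsto_nhds_unique h1 (h2.congr fun N => ?_)
  · linarith
  · simp only [betaTrunc]
    simp only [Finset.mul_sum]
    rw [Finset.sum_comm, ← Finset.sum_sub_distrib]
    refine Finset.sum_congr rfl fun j _ => ?_
    have := cosMoment_odd m j
    rw [← Finset.mul_sum]
    linear_combination (-2) * this

/-! ### The double zeta value and the limit of the truncations -/

theorem harm_nonneg (n : ℕ) : 0 ≤ harm n := Finset.sum_nonneg fun _ _ => by positivity

theorem harm_le (n : ℕ) : harm n ≤ n := by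
  induction n with
  | zero => simp [harm]
  | succ n ih =>
    rw [harm_succ]
    push_cast
    have : 1 / ((n : ℝ) + 1) ≤ 1 := by
      rw [div_le_one (by positivity)]
      linarith [(Nat.cast_nonneg n : (0 : ℝ) ≤ n)]
    linarith

theorem summable_altZeta {s : ℕ} (hs : 3 ≤ s) :
    Summable fun n : ℕ => (-1) ^ (n + 1) / ((n : ℝ) + 1) ^ s * harm n := by
  refine Summable.of_norm_bounded (hasSum_zetaVal le_rfl).summable fun n => ?_
  rw [norm_mul, norm_div, norm_pow, norm_pow, norm_neg, norm_one, one_pow,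
    Real.norm_of_nonneg (harm_nonneg n), Real.norm_of_nonneg (by positivity : (0 : ℝ) ≤ n + 1)]
  have h1 : ((n : ℝ) + 1) ^ 3 ≤ ((n : ℝ) + 1) ^ s :=
    pow_le_pow_right₀ (by linarith [(Nat.cast_nonneg n : (0 : ℝ) ≤ n)]) hs
  calc _ ≤ 1 / ((n : ℝ) + 1) ^ 3 * (n + 1) := by
        gcongr
        · exact harm_nonneg n
        · linarith [harm_le n]
    _ = _ := by field_simp

theorem tendsto_altZetaTrunc {s : ℕ} (hs : 3 ≤ s) :
    Tendsto (altZetaTrunc ![-1, 1] ![s, 1]) atTop (𝓝 (altZeta ![-1, 1] ![s, 1])) := by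
  have h := (summable_altZeta hs).hasSum.tendsto_sum_nat
  refine tendsto_nhds_limUnder ⟨_, h.congr fun N => ?_⟩
  rw [altZetaTrunc_eq, sum_Icc_one_eq]
  refine Finset.sum_congr rfl fun n _ => ?_
  rw [harm, Nat.add_sub_cancel]
  push_cast
  rfl

theorem hasSum_altZeta {s : ℕ} (hs : 3 ≤ s) :
    HasSum (fun n : ℕ => (-1) ^ (n + 1) / ((n : ℝ) + 1) ^ s * harm n)
      (altZeta ![-1, 1] ![s, 1]) := by
  have h := (summable_altZeta hs).hasSum
  have e := tendsto_nhds_unique h.tendsto_sum_nat ((tendsto_altZetaTrunc hs).congr fun N => ?_)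
  · rwa [e] at h
  · rw [altZetaTrunc_eq, sum_Icc_one_eq]
    refine Finset.sum_congr rfl fun n _ => ?_
    rw [harm, Nat.add_sub_cancel]
    push_cast
    rfl

theorem exists_abs_altHarm_le : ∃ B, ∀ k, |altHarm k| ≤ B := by
  obtain ⟨B, hB⟩ := (Metric.isBounded_range_of_tendsto altHarm tendsto_altHarm).exists_norm_le
  exact ⟨B, fun k => hB _ ⟨k, rfl⟩⟩

theorem summable_mul_altHarm {b : ℕ → ℝ} (hb : Summable b) (hb0 : ∀ k, 0 ≤ b k) (φ : ℕ → ℕ)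
    (L : ℝ) : Summable fun k => b k * (L - altHarm (φ k)) := by
  obtain ⟨B, hB⟩ := exists_abs_altHarm_le
  refine Summable.of_norm_bounded (hb.mul_right (|L| + B)) fun k => ?_
  rw [norm_mul, Real.norm_of_nonneg (hb0 k), Real.norm_eq_abs]
  refine mul_le_mul_of_nonneg_left ((abs_sub _ _).trans ?_) (hb0 k)
  linarith [hB (φ k)]

theorem cosIntegral_odd' (k : ℕ) : cosIntegral (2 * k + 1) = Real.log 2 + harm k - altHarm k := by
  rw [cosIntegral_odd, harm, altHarm, add_sub_assoc, ← Finset.sum_sub_distrib]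
  congr 1
  exact Finset.sum_congr rfl fun i _ => by ring

/-- A termwise identity. Writing m = n+1, both H_{m-1} and the alternating sum up to m are
combinations of H_k and the odd harmonic sum O_k with k = ⌊m/2⌋, apart from explicit 1/m terms;
together they reproduce the integral for even m. For odd m a correction with the alternating sum up
to (m-1)/2 is left over, and it feeds the beta convolution. -/
theorem hasSum_cosIntegral {ℓ : ℕ} (hℓ : 1 ≤ ℓ) :
    HasSum (fun n : ℕ => 2 * (-1) ^ (n + 1) * cosIntegral (n + 1) / ((n : ℝ) + 1) ^ (2 * ℓ + 1))
      (2 * altZeta ![-1, 1] ![2 * ℓ + 1, 1] +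
        ∑ x ∈ Finset.HasAntidiagonal.antidiagonal (2 * ℓ),
          (-1) ^ x.1 * etaVal (x.1 + 1) * etaVal (x.2 + 1) +
        2 * Real.log 2 * zetaVal (2 * ℓ + 1) - 2 * etaVal (2 * ℓ + 2) +
        2 * ∑ x ∈ Finset.HasAntidiagonal.antidiagonal (2 * ℓ),
          (-1) ^ x.1 * betaVal (x.1 + 1) * betaVal (x.2 + 1) -
        4 * Real.log 2 * lamVal (2 * ℓ + 1)) := by
  have h1 := (hasSum_altZeta (s := 2 * ℓ + 1) (by omega)).mul_left 2
  have h2 := ((summable_mul_altHarm (b := fun k : ℕ => 1 / ((k : ℝ) + 1) ^ (2 * ℓ + 1))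
    (hasSum_zetaVal (by omega)).summable (fun k => by positivity) (fun k => k + 1)
    (-Real.log 2)).hasSum).mul_left 2
  rw [← sum_etaVal_mul_etaVal hℓ] at h2
  have h3 := (hasSum_zetaVal (s := 2 * ℓ + 1) (by omega)).mul_left (2 * Real.log 2)
  have h4 := (hasSum_etaVal (s := 2 * ℓ + 2) (by omega)).mul_left 2
  have h5 := (((summable_mul_altHarm (b := fun k : ℕ => 1 / (2 * (k : ℝ) + 1) ^ (2 * ℓ + 1))
    (hasSum_lamVal (by omega)).summable (fun k => by positivity) (fun k => k)
    (-Real.log 2)).hasSum).neg).mul_left 2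
  rw [← sum_betaVal_mul_betaVal hℓ] at h5
  have h6 := (hasSum_lamVal (s := 2 * ℓ + 1) (by omega)).mul_left (4 * Real.log 2)
  have h7 := h5.sub h6
  -- The correction lives on odd denominators n + 1, that is, on even n.
  have h8 := HasSum.even_add_odd (f := fun n : ℕ => if n % 2 = 0 then
      (2 * altHarm (n / 2) - 2 * Real.log 2) / ((n : ℝ) + 1) ^ (2 * ℓ + 1) else 0)
    (hasSum_of_eq (fun k => by
      rw [if_pos (by omega), show 2 * k / 2 = k by omega]
      push_cast
      ring) h7)
    (hasSum_of_eq (fun k => by rw [if_neg (by omega)]) hasSum_zero)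
  have h := (((h1.add h2).add h3).sub h4).add h8
  rw [add_zero, ← add_sub_assoc] at h
  refine hasSum_of_eq (fun n => ?_) h
  have hn : ((n : ℝ) + 1) ≠ 0 := by positivity
  obtain ⟨k, rfl | rfl⟩ := Nat.even_or_odd' n
  · rw [if_pos (by omega), show 2 * k / 2 = k by omega, cosIntegral_odd', harm_two_mul,
      altHarm_succ, altHarm_two_mul, pow_succ, pow_mul]
    push_cast at hn ⊢
    norm_num
    field_simp
    ring
  · rw [if_neg (by omega), show 2 * k + 1 + 1 = 2 * (k + 1) by ring, cosIntegral_even,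
      altHarm_two_mul, harm_succ (2 * k), harm_two_mul, ← oddHarm, oddHarm_succ, harm_succ,
      pow_mul, pow_succ _ (2 * k), pow_mul]
    push_cast at hn ⊢
    norm_num
    field_simp
    ring

/-- The value of the alternating multiple `S` value in terms of products of depth one values. -/
theorem tendsto_multSTrunc {ℓ : ℕ} (hℓ : 1 ≤ ℓ) :
    Tendsto (multSTrunc (barFirst (2 * ℓ)) (twoOnes (2 * ℓ))) atTop
      (𝓝 (2 * altZeta ![-1, 1] ![2 * ℓ + 1, 1] +
        ∑ x ∈ Finset.HasAntidiagonal.antidiagonal (2 * ℓ),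
          (-1) ^ x.1 * etaVal (x.1 + 1) * etaVal (x.2 + 1) +
        2 * Real.log 2 * zetaVal (2 * ℓ + 1) - 2 * etaVal (2 * ℓ + 2) +
        2 * ∑ x ∈ Finset.HasAntidiagonal.antidiagonal (2 * ℓ),
          (-1) ^ x.1 * betaVal (x.1 + 1) * betaVal (x.2 + 1) -
        4 * Real.log 2 * lamVal (2 * ℓ + 1) -
        4 * ∑ i ∈ Finset.range ℓ, etaVal (2 * (ℓ - i) - 1) * (lamVal (2 * i + 3) -
          ∑ k ∈ Finset.range (i + 1), sinCoeff k * betaVal (2 * (i + 1 - k))))) := by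
  have h1 := (hasSum_cosIntegral hℓ).tendsto_sum_nat
  have h2 : Tendsto (fun N => ∑ i ∈ Finset.range ℓ, etaTrunc (2 * (ℓ - i) - 1) N *
      (lamVal (2 * i + 3) - ∑ k ∈ Finset.range (i + 1), sinCoeff k * betaVal (2 * (i + 1 - k))))
      atTop (𝓝 (∑ i ∈ Finset.range ℓ, etaVal (2 * (ℓ - i) - 1) *
      (lamVal (2 * i + 3) - ∑ k ∈ Finset.range (i + 1),
        sinCoeff k * betaVal (2 * (i + 1 - k))))) := by
    refine tendsto_finsetSum _ fun i hi => ?_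
    rw [Finset.mem_range] at hi
    exact (tendsto_etaTrunc (by omega)).mul_const _
  have h := (tendsto_multSTrunc_sub hℓ).add (h1.sub (h2.const_mul 4))
  rw [zero_add] at h
  refine h.congr fun N => ?_
  have e : (-1) ^ ℓ * (2 * ∑ n ∈ Finset.Icc 1 N, (-1) ^ n * sinPrimIntegral (2 * ℓ + 1) n) =
      ∑ n ∈ Finset.range N,
        2 * (-1) ^ (n + 1) * cosIntegral (n + 1) / ((n : ℝ) + 1) ^ (2 * ℓ + 1) -
      4 * ∑ i ∈ Finset.range ℓ, etaTrunc (2 * (ℓ - i) - 1) N *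
      (lamVal (2 * i + 3) - ∑ k ∈ Finset.range (i + 1),
        sinCoeff k * betaVal (2 * (i + 1 - k))) := by
    have e1 : ∑ n ∈ Finset.range N,
        2 * (-1) ^ (n + 1) * cosIntegral (n + 1) / ((n : ℝ) + 1) ^ (2 * ℓ + 1) =
        ∑ n ∈ Finset.Icc 1 N, 2 * (-1) ^ n * cosIntegral n / (n : ℝ) ^ (2 * ℓ + 1) := by
      rw [sum_Icc_one_eq]
      push_cast
      rfl
    have e2 : ∀ i, 4 * (etaTrunc (2 * (ℓ - i) - 1) N * (lamVal (2 * i + 3) -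
        ∑ k ∈ Finset.range (i + 1), sinCoeff k * betaVal (2 * (i + 1 - k)))) =
        -∑ n ∈ Finset.Icc 1 N, 2 * (-1) ^ n * ((-1) ^ (i + 1) * powIntegral (2 * i + 2) /
          (n : ℝ) ^ (2 * (ℓ - i) - 1)) := by
      intro i
      rw [← neg_neg (etaTrunc _ N), ← sum_alternating_eq_neg_etaTrunc, neg_mul, mul_neg,
        Finset.sum_mul, Finset.mul_sum, neg_one_pow_mul_powIntegral]
      congr 1
      exact Finset.sum_congr rfl fun n _ => by ring
    rw [e1, Finset.mul_sum (Finset.range ℓ)]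
    simp only [e2]
    rw [Finset.sum_neg_distrib, sub_neg_eq_add, Finset.sum_comm, ← Finset.sum_add_distrib,
      Finset.mul_sum, Finset.mul_sum]
    refine Finset.sum_congr rfl fun n hn => ?_
    have := sinPrimIntegral_eq ℓ (n := n) (by have := (Finset.mem_Icc.1 hn).1; omega)
    rw [← Finset.mul_sum]
    linear_combination 2 * (-1) ^ n * this
  rw [e]
  ring

/-! ### Reindexing towards the stated formula -/

/-- The coefficients of the product of the sine series with the generating series of the values
of the beta function. -/
noncomputable def sinBetaCoeff (m : ℕ) : ℝ :=
  ∑ k ∈ Finset.range (m / 2 + 1), sinCoeff k * betaVal (m - 2 * k + 1)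

theorem sinBetaCoeff_even (m : ℕ) : sinBetaCoeff (2 * m) = lamVal (2 * m + 2) := by
  rw [lamVal_even, sinBetaCoeff, show 2 * m / 2 = m by omega]
  refine Finset.sum_congr rfl fun k _ => ?_
  rw [show 2 * m - 2 * k = 2 * (m - k) by omega]

theorem sinBetaCoeff_odd (i : ℕ) : sinBetaCoeff (2 * i + 1) =
    ∑ k ∈ Finset.range (i + 1), sinCoeff k * betaVal (2 * (i + 1 - k)) := by
  rw [sinBetaCoeff, show (2 * i + 1) / 2 = i by omega]
  refine Finset.sum_congr rfl fun k hk => ?_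
  rw [Finset.mem_range] at hk
  rw [show 2 * i + 1 - 2 * k + 1 = 2 * (i + 1 - k) by omega]

theorem sum_filter_eq_sum_range (a m : ℕ) (hm : m < a) (f : ℕ × ℕ → ℝ) :
    ∑ x ∈ Finset.range a ×ˢ Finset.range a with x.1 + 2 * x.2 = m, f x =
      ∑ k ∈ Finset.range (m / 2 + 1), f (m - 2 * k, k) := by
  refine Finset.sum_bij' (fun x _ => x.2) (fun k _ => (m - 2 * k, k)) ?_ ?_ ?_ ?_ ?_
  · rintro ⟨r, k⟩ h
    simp only [Finset.mem_filter, Finset.mem_product, Finset.mem_range] at h ⊢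
    omega
  · intro k h
    simp only [Finset.mem_filter, Finset.mem_product, Finset.mem_range] at h ⊢
    omega
  · rintro ⟨r, k⟩ h
    simp only [Finset.mem_filter, Finset.mem_product, Finset.mem_range] at h
    simp only [Prod.mk.injEq, and_true]
    omega
  · intro k _
    rfl
  · rintro ⟨r, k⟩ h
    simp only [Finset.mem_filter, Finset.mem_product, Finset.mem_range] at h
    rw [show m - 2 * k = r by omega]

theorem sum_filter_triple_eq (ℓ : ℕ) (f : ℕ × ℕ × ℕ → ℝ) :
    ∑ x ∈ Finset.range (2 * ℓ) ×ˢ Finset.range (2 * ℓ) ×ˢ Finset.range (2 * ℓ) with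
        1 ≤ x.1 ∧ x.1 + x.2.1 + 2 * x.2.2 + 1 = 2 * ℓ, f x =
      ∑ p ∈ Finset.range (2 * ℓ - 1), ∑ k ∈ Finset.range ((2 * ℓ - 2 - p) / 2 + 1),
        f (p + 1, 2 * ℓ - 2 - p - 2 * k, k) := by
  rw [Finset.sum_sigma']
  refine Finset.sum_bij' (fun x _ => (⟨x.1 - 1, x.2.2⟩ : Σ _ : ℕ, ℕ))
    (fun y _ => (y.1 + 1, 2 * ℓ - 2 - y.1 - 2 * y.2, y.2)) ?_ ?_ ?_ ?_ ?_
  · rintro ⟨p, r, k⟩ h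
    simp only [Finset.mem_filter, Finset.mem_product, Finset.mem_range, Finset.mem_sigma] at h ⊢
    omega
  · rintro ⟨p, k⟩ h
    simp only [Finset.mem_filter, Finset.mem_product, Finset.mem_range, Finset.mem_sigma] at h ⊢
    omega
  · rintro ⟨p, r, k⟩ h
    simp only [Finset.mem_filter, Finset.mem_product, Finset.mem_range] at h
    simp only [Prod.mk.injEq, and_true]
    omega
  · rintro ⟨p, k⟩ _
    simp
  · rintro ⟨p, r, k⟩ h
    simp only [Finset.mem_filter, Finset.mem_product, Finset.mem_range] at h
    simp only
    rw [show p - 1 + 1 = p by omega, show 2 * ℓ - 2 - (p - 1) - 2 * k = r by omega]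

theorem sum_filter_antidiagonal_eq (ℓ : ℕ) (f : ℕ × ℕ → ℝ) :
    ∑ x ∈ Finset.HasAntidiagonal.antidiagonal (2 * ℓ + 2) with 2 ≤ x.1 ∧ 2 ≤ x.2, f x =
      ∑ p ∈ Finset.range (2 * ℓ - 1), f (p + 2, 2 * ℓ - p) := by
  refine Finset.sum_bij' (fun x _ => x.1 - 2) (fun p _ => (p + 2, 2 * ℓ - p)) ?_ ?_ ?_ ?_ ?_
  · rintro ⟨p, q⟩ h
    simp only [Finset.mem_filter, Finset.HasAntidiagonal.mem_antidiagonal, Finset.mem_range] at h ⊢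
    omega
  · intro p h
    simp only [Finset.mem_filter, Finset.HasAntidiagonal.mem_antidiagonal, Finset.mem_range] at h ⊢
    omega
  · rintro ⟨p, q⟩ h
    simp only [Finset.mem_filter, Finset.HasAntidiagonal.mem_antidiagonal] at h
    simp only [Prod.mk.injEq]
    omega
  · intro p _
    simp
  · rintro ⟨p, q⟩ h
    simp only [Finset.mem_filter, Finset.HasAntidiagonal.mem_antidiagonal] at h
    rw [show p - 2 + 2 = p by omega, show 2 * ℓ - (p - 2) = q by omega]

theorem sum_range_two_mul (ℓ : ℕ) (F : ℕ → ℝ) : ∑ p ∈ Finset.range (2 * ℓ), F p =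
    ∑ j ∈ Finset.range ℓ, F (2 * j) + ∑ j ∈ Finset.range ℓ, F (2 * j + 1) := by
  induction ℓ with
  | zero => simp
  | succ ℓ ih =>
    rw [show 2 * (ℓ + 1) = 2 * ℓ + 1 + 1 by ring, Finset.sum_range_succ, Finset.sum_range_succ, ih,
      Finset.sum_range_succ, Finset.sum_range_succ]
    ring

theorem two_zpow_neg_natCast (n : ℕ) : (2 : ℝ) ^ (-(n : ℤ)) = (1 / 2) ^ n := by
  rw [zpow_neg, zpow_natCast, one_div_pow, one_div]

theorem two_zpow_one_sub_natCast (n : ℕ) : (2 : ℝ) ^ (1 - (n : ℤ)) = 2 * (1 / 2) ^ n := by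
  rw [sub_eq_add_neg, zpow_add₀ two_ne_zero, zpow_one, two_zpow_neg_natCast]

theorem etaVal_of_two_le {s : ℕ} (hs : 2 ≤ s) :
    etaVal s = (1 - 2 * (1 / 2) ^ s) * zetaVal s := by
  rw [etaVal, if_neg (by omega)]

theorem etaVal_one : etaVal 1 = Real.log 2 := by
  rw [etaVal, if_pos rfl]

theorem neg_one_pow_even (j : ℕ) : (-1 : ℝ) ^ (2 * j) = 1 := by
  rw [pow_mul]
  simp

/-- Since (1-2^{-p})ζ(p+1) = η(p+1) and log 2 = η(1), the two sums form a single convolution, the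
logarithmic one being p = 0. For odd p the beta factor collapses to a λ value; these terms cancel
against those of `sum_zeta_zeta`. -/
theorem sum_log_beta_add_sum_zeta_beta {ℓ : ℕ} (hℓ : 1 ≤ ℓ) :
    (∑ x ∈ Finset.range (2 * ℓ) ×ˢ Finset.range (2 * ℓ) with x.1 + 2 * x.2 + 1 = 2 * ℓ,
      4 * Real.log 2 * betaVal (x.1 + 1) * ((-1) ^ x.2 / ((2 * x.2 + 1).factorial : ℝ)) *
        (Real.pi / 2) ^ (2 * x.2 + 1)) +
    (∑ x ∈ Finset.range (2 * ℓ) ×ˢ Finset.range (2 * ℓ) ×ˢ Finset.range (2 * ℓ) with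
      1 ≤ x.1 ∧ x.1 + x.2.1 + 2 * x.2.2 + 1 = 2 * ℓ,
      4 * (-1) ^ (x.1 + x.2.2) * betaVal (x.2.1 + 1) * (1 - (2 : ℝ) ^ (-(x.1 : ℤ))) *
        zetaVal (x.1 + 1) * (1 / ((2 * x.2.2 + 1).factorial : ℝ)) *
        (Real.pi / 2) ^ (2 * x.2.2 + 1)) =
    4 * (∑ j ∈ Finset.range ℓ, etaVal (2 * j + 1) * sinBetaCoeff (2 * (ℓ - 1 - j) + 1) -
      ∑ j ∈ Finset.range ℓ, etaVal (2 * j + 2) * lamVal (2 * (ℓ - j))) := by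
  have h1 : (∑ x ∈ Finset.range (2 * ℓ) ×ˢ Finset.range (2 * ℓ) with x.1 + 2 * x.2 + 1 = 2 * ℓ,
      4 * Real.log 2 * betaVal (x.1 + 1) * ((-1) ^ x.2 / ((2 * x.2 + 1).factorial : ℝ)) *
        (Real.pi / 2) ^ (2 * x.2 + 1)) = 4 * (etaVal 1 * sinBetaCoeff (2 * ℓ - 1)) := by
    rw [Finset.filter_congr (q := fun x : ℕ × ℕ => x.1 + 2 * x.2 = 2 * ℓ - 1)
      (fun x _ => by omega), sum_filter_eq_sum_range _ _ (by omega), sinBetaCoeff, etaVal_one,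
      Finset.mul_sum, Finset.mul_sum]
    refine Finset.sum_congr rfl fun k _ => ?_
    rw [sinCoeff]
    ring
  have h2 : ∑ p ∈ Finset.range (2 * ℓ - 1), ∑ k ∈ Finset.range ((2 * ℓ - 2 - p) / 2 + 1),
      4 * (-1) ^ (p + 1 + k) * betaVal (2 * ℓ - 2 - p - 2 * k + 1) *
        (1 - (2 : ℝ) ^ (-((p + 1 : ℕ) : ℤ))) * zetaVal (p + 1 + 1) *
        (1 / ((2 * k + 1).factorial : ℝ)) * (Real.pi / 2) ^ (2 * k + 1) =
      4 * ∑ p ∈ Finset.range (2 * ℓ - 1),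
        (-1) ^ (p + 1) * etaVal (p + 1 + 1) * sinBetaCoeff (2 * ℓ - 1 - (p + 1)) := by
    rw [Finset.mul_sum]
    refine Finset.sum_congr rfl fun p _ => ?_
    rw [show 2 * ℓ - 1 - (p + 1) = 2 * ℓ - 2 - p by omega, sinBetaCoeff, Finset.mul_sum,
      Finset.mul_sum]
    refine Finset.sum_congr rfl fun k _ => ?_
    rw [two_zpow_neg_natCast, etaVal_of_two_le (by omega), sinCoeff, pow_add (-1 : ℝ) (p + 1) k,
      pow_succ (1 / 2 : ℝ) (p + 1)]
    ring
  have h3 := sum_range_two_mul ℓ fun p => (-1) ^ p * etaVal (p + 1) * sinBetaCoeff (2 * ℓ - 1 - p)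
  have h4 : ∑ p ∈ Finset.range (2 * ℓ), (-1) ^ p * etaVal (p + 1) * sinBetaCoeff (2 * ℓ - 1 - p) =
      ∑ p ∈ Finset.range (2 * ℓ - 1),
        (-1) ^ (p + 1) * etaVal (p + 1 + 1) * sinBetaCoeff (2 * ℓ - 1 - (p + 1)) +
      etaVal 1 * sinBetaCoeff (2 * ℓ - 1) := by
    obtain ⟨n, hn⟩ : ∃ n, 2 * ℓ = n + 1 := ⟨2 * ℓ - 1, by omega⟩
    rw [hn, Finset.sum_range_succ', Nat.add_sub_cancel]
    simp
  have h5 : ∑ j ∈ Finset.range ℓ,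
      (-1) ^ (2 * j) * etaVal (2 * j + 1) * sinBetaCoeff (2 * ℓ - 1 - 2 * j) =
      ∑ j ∈ Finset.range ℓ, etaVal (2 * j + 1) * sinBetaCoeff (2 * (ℓ - 1 - j) + 1) := by
    refine Finset.sum_congr rfl fun j hj => ?_
    rw [Finset.mem_range] at hj
    rw [neg_one_pow_even, one_mul, show 2 * ℓ - 1 - 2 * j = 2 * (ℓ - 1 - j) + 1 by omega]
  have h6 : ∑ j ∈ Finset.range ℓ,
      (-1) ^ (2 * j + 1) * etaVal (2 * j + 1 + 1) * sinBetaCoeff (2 * ℓ - 1 - (2 * j + 1)) =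
      -∑ j ∈ Finset.range ℓ, etaVal (2 * j + 2) * lamVal (2 * (ℓ - j)) := by
    rw [← Finset.sum_neg_distrib]
    refine Finset.sum_congr rfl fun j hj => ?_
    rw [Finset.mem_range] at hj
    rw [pow_succ, neg_one_pow_even, show 2 * ℓ - 1 - (2 * j + 1) = 2 * (ℓ - 1 - j) by omega,
      sinBetaCoeff_even, show 2 * (ℓ - 1 - j) + 2 = 2 * (ℓ - j) by omega]
    ring
  rw [h1, sum_filter_triple_eq, h2]
  rw [h4, h5, h6] at h3
  linear_combination 4 * h3

/-- The unusual factor splits as (3-2^{1-q})ζ(q) = 4λ(q) - η(q). Completing the ranges by the terms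
containing η(1) = log 2 accounts for the logarithmic corrections. -/
theorem sum_zeta_zeta {ℓ : ℕ} (hℓ : 1 ≤ ℓ) :
    (∑ x ∈ Finset.HasAntidiagonal.antidiagonal (2 * ℓ + 2) with 2 ≤ x.1 ∧ 2 ≤ x.2,
      (-1) ^ x.1 * (1 - (2 : ℝ) ^ (1 - (x.1 : ℤ))) * (3 - (2 : ℝ) ^ (1 - (x.2 : ℤ))) *
        zetaVal x.1 * zetaVal x.2) =
    ∑ x ∈ Finset.HasAntidiagonal.antidiagonal (2 * ℓ),
      (-1) ^ x.1 * etaVal (x.1 + 1) * etaVal (x.2 + 1) - 2 * Real.log 2 * etaVal (2 * ℓ + 1) -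
    4 * (∑ j ∈ Finset.range ℓ, etaVal (2 * j + 1) * lamVal (2 * (ℓ - 1 - j) + 3) -
      ∑ j ∈ Finset.range ℓ, etaVal (2 * j + 2) * lamVal (2 * (ℓ - j)) -
      Real.log 2 * lamVal (2 * ℓ + 1)) := by
  have h1 : ∑ p ∈ Finset.range (2 * ℓ - 1), (-1) ^ (p + 2) *
      (1 - (2 : ℝ) ^ (1 - ((p + 2 : ℕ) : ℤ))) * (3 - (2 : ℝ) ^ (1 - ((2 * ℓ - p : ℕ) : ℤ))) *
        zetaVal (p + 2) * zetaVal (2 * ℓ - p) =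
      ∑ p ∈ Finset.range (2 * ℓ - 1), (-1) ^ (p + 1) * etaVal (p + 1 + 1) *
        etaVal (2 * ℓ - (p + 1) + 1) - 4 * ∑ p ∈ Finset.range (2 * ℓ - 1), (-1) ^ (p + 1) *
        etaVal (p + 1 + 1) * lamVal (2 * ℓ - (p + 1) + 1) := by
    rw [Finset.mul_sum, ← Finset.sum_sub_distrib]
    refine Finset.sum_congr rfl fun p hp => ?_
    rw [Finset.mem_range] at hp
    rw [show 2 * ℓ - (p + 1) + 1 = 2 * ℓ - p by omega, etaVal_of_two_le (by omega),
      etaVal_of_two_le (by omega), lamVal, two_zpow_one_sub_natCast, two_zpow_one_sub_natCast]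
    ring
  have h2 : ∀ g : ℕ → ℝ, ∑ p ∈ Finset.range (2 * ℓ), g p =
      ∑ p ∈ Finset.range (2 * ℓ - 1), g (p + 1) + g 0 := by
    intro g
    obtain ⟨n, hn⟩ : ∃ n, 2 * ℓ = n + 1 := ⟨2 * ℓ - 1, by omega⟩
    rw [hn, Finset.sum_range_succ', Nat.add_sub_cancel]
  have h3 := h2 fun p => (-1) ^ p * etaVal (p + 1) * etaVal (2 * ℓ - p + 1)
  have h4 := h2 fun p => (-1) ^ p * etaVal (p + 1) * lamVal (2 * ℓ - p + 1)
  rw [sum_range_two_mul] at h4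
  have h5 : ∑ j ∈ Finset.range ℓ,
      (-1) ^ (2 * j) * etaVal (2 * j + 1) * lamVal (2 * ℓ - 2 * j + 1) =
      ∑ j ∈ Finset.range ℓ, etaVal (2 * j + 1) * lamVal (2 * (ℓ - 1 - j) + 3) := by
    refine Finset.sum_congr rfl fun j hj => ?_
    rw [Finset.mem_range] at hj
    rw [neg_one_pow_even, one_mul, show 2 * ℓ - 2 * j + 1 = 2 * (ℓ - 1 - j) + 3 by omega]
  have h6 : ∑ j ∈ Finset.range ℓ,
      (-1) ^ (2 * j + 1) * etaVal (2 * j + 1 + 1) * lamVal (2 * ℓ - (2 * j + 1) + 1) =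
      -∑ j ∈ Finset.range ℓ, etaVal (2 * j + 2) * lamVal (2 * (ℓ - j)) := by
    rw [← Finset.sum_neg_distrib]
    refine Finset.sum_congr rfl fun j hj => ?_
    rw [Finset.mem_range] at hj
    rw [pow_succ, neg_one_pow_even, show 2 * ℓ - (2 * j + 1) + 1 = 2 * (ℓ - j) by omega]
    ring
  rw [h5, h6] at h4
  rw [sum_filter_antidiagonal_eq, h1, Finset.Nat.sum_antidiagonal_eq_sum_range_succ_mk,
    Finset.sum_range_succ, h3, neg_one_pow_even]
  simp only [pow_zero, zero_add, Nat.sub_zero, Nat.sub_self, etaVal_one, one_mul] at h4 ⊢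
  linear_combination 4 * h4

theorem sum_beta_pi (ℓ : ℕ) :
    (∑ x ∈ Finset.range (2 * ℓ + 1) ×ˢ Finset.range (2 * ℓ + 1) with x.1 + 2 * x.2 = 2 * ℓ,
      2 * betaVal (x.1 + 1) * ((-1) ^ (x.2 + 1) / ((2 * x.2 + 1).factorial : ℝ)) *
        (Real.pi / 2) ^ (2 * x.2 + 1)) = -2 * lamVal (2 * ℓ + 2) := by
  rw [sum_filter_eq_sum_range _ _ (by omega), ← sinBetaCoeff_even, sinBetaCoeff, Finset.mul_sum]
  refine Finset.sum_congr rfl fun k _ => ?_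
  rw [sinCoeff, pow_succ]
  ring

/-! ### Rationality and membership in the generated algebra -/

/-- Rational multiples of the `n`-th power of `π`. -/
def IsRatMulPiPow (n : ℕ) (x : ℝ) : Prop := ∃ q : ℚ, x = q * Real.pi ^ n

theorem IsRatMulPiPow.sum {ι : Type*} (s : Finset ι) {n : ℕ} {f : ι → ℝ}
    (h : ∀ i ∈ s, IsRatMulPiPow n (f i)) : IsRatMulPiPow n (∑ i ∈ s, f i) := by
  choose! q hq using h
  refine ⟨∑ i ∈ s, q i, ?_⟩
  rw [Finset.sum_congr rfl hq]
  push_cast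
  rw [Finset.sum_mul]

theorem IsRatMulPiPow.mul {m n : ℕ} {x y : ℝ} (hx : IsRatMulPiPow m x) (hy : IsRatMulPiPow n y) :
    IsRatMulPiPow (m + n) (x * y) := by
  obtain ⟨p, rfl⟩ := hx
  obtain ⟨q, rfl⟩ := hy
  refine ⟨p * q, ?_⟩
  push_cast
  ring

theorem IsRatMulPiPow.sub {n : ℕ} {x y : ℝ} (hx : IsRatMulPiPow n x) (hy : IsRatMulPiPow n y) :
    IsRatMulPiPow n (x - y) := by
  obtain ⟨p, rfl⟩ := hx
  obtain ⟨q, rfl⟩ := hy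
  refine ⟨p - q, ?_⟩
  push_cast
  ring

theorem isRatMulPiPow_sinCoeff (k : ℕ) : IsRatMulPiPow (2 * k + 1) (sinCoeff k) := by
  refine ⟨(-1) ^ k / ((2 * k + 1).factorial : ℚ) / 2 ^ (2 * k + 1), ?_⟩
  rw [sinCoeff, div_pow]
  push_cast
  ring

theorem isRatMulPiPow_zetaVal (m : ℕ) : IsRatMulPiPow (2 * m + 2) (zetaVal (2 * m + 2)) := by
  have h := riemannZeta_two_mul_nat (k := m + 1) (by omega)
  refine ⟨(-1) ^ (m + 1 + 1) * 2 ^ (2 * (m + 1) - 1) * bernoulli (2 * (m + 1)) /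
    ((2 * (m + 1)).factorial : ℚ), ?_⟩
  have h2 : (zetaVal (2 * m + 2) : ℂ) = riemannZeta ((2 * m + 2 : ℕ) : ℂ) := zetaVal_eq (by omega)
  have h3 : ((2 * m + 2 : ℕ) : ℂ) = 2 * ((m + 1 : ℕ) : ℂ) := by
    push_cast
    ring
  rw [h3, h] at h2
  apply Complex.ofReal_injective
  rw [h2]
  push_cast
  rw [show 2 * (m + 1) = 2 * m + 2 by ring]
  ring

theorem isRatMulPiPow_lamVal (m : ℕ) : IsRatMulPiPow (2 * m + 2) (lamVal (2 * m + 2)) := by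
  obtain ⟨q, hq⟩ := isRatMulPiPow_zetaVal m
  refine ⟨(1 - (1 / 2) ^ (2 * m + 2)) * q, ?_⟩
  rw [lamVal, hq]
  push_cast
  ring

/-- In `lamVal_even` the k = 0 term is (π/2) β(2m+1) and the others involve smaller odd arguments,
so the relation is solved for β(2m+1) after cancelling one π. -/
theorem isRatMulPiPow_betaVal (m : ℕ) : IsRatMulPiPow (2 * m + 1) (betaVal (2 * m + 1)) := by
  induction m using Nat.strong_induction_on with
  | _ m ih =>
    have h := lamVal_even m
    rw [Finset.sum_range_succ'] at h
    have h1 : IsRatMulPiPow (2 * m + 2)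
        (∑ k ∈ Finset.range m, sinCoeff (k + 1) * betaVal (2 * (m - (k + 1)) + 1)) := by
      refine IsRatMulPiPow.sum _ fun k hk => ?_
      rw [Finset.mem_range] at hk
      have := (isRatMulPiPow_sinCoeff (k + 1)).mul (ih (m - (k + 1)) (by omega))
      rwa [show 2 * (k + 1) + 1 + (2 * (m - (k + 1)) + 1) = 2 * m + 2 by omega] at this
    obtain ⟨q, hq⟩ := (isRatMulPiPow_lamVal m).sub h1
    rw [h] at hq
    refine ⟨q * 2, ?_⟩
    have hpi := Real.pi_ne_zero
    have h0 : sinCoeff 0 = Real.pi / 2 := by simp [sinCoeff]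
    rw [h0, Nat.sub_zero, add_sub_cancel_left, pow_succ] at hq
    push_cast
    apply mul_left_cancel₀ hpi
    linear_combination 2 * hq

section Adjoin

variable {A : Subalgebra ℚ ℝ}

theorem ratCast_mem_subalgebra (q : ℚ) : (q : ℝ) ∈ A := A.algebraMap_mem q

theorem IsRatMulPiPow.mem {n : ℕ} {x : ℝ} (hx : IsRatMulPiPow n x) (hpi : Real.pi ∈ A) : x ∈ A := by
  obtain ⟨q, rfl⟩ := hx
  exact A.mul_mem (ratCast_mem_subalgebra q) (A.pow_mem hpi n)

theorem zetaVal_mem (hpi : Real.pi ∈ A) (hζ : ∀ k : ℕ, 1 ≤ k → zetaVal (2 * k + 1) ∈ A) {s : ℕ}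
    (hs : 2 ≤ s) : zetaVal s ∈ A := by
  obtain ⟨k, rfl | rfl⟩ := Nat.even_or_odd' s
  · have := (isRatMulPiPow_zetaVal (k - 1)).mem hpi
    rwa [show 2 * (k - 1) + 2 = 2 * k by omega] at this
  · exact hζ k (by omega)

theorem lamVal_mem (hpi : Real.pi ∈ A) (hζ : ∀ k : ℕ, 1 ≤ k → zetaVal (2 * k + 1) ∈ A) {s : ℕ}
    (hs : 2 ≤ s) : lamVal s ∈ A := by
  have h := ratCast_mem_subalgebra (A := A) (1 - (1 / 2) ^ s)
  push_cast at h
  exact A.mul_mem h (zetaVal_mem hpi hζ hs)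

theorem etaVal_mem (hlog : Real.log 2 ∈ A) (hpi : Real.pi ∈ A)
    (hζ : ∀ k : ℕ, 1 ≤ k → zetaVal (2 * k + 1) ∈ A) {s : ℕ} (hs : 1 ≤ s) : etaVal s ∈ A := by
  rcases hs.eq_or_lt with rfl | hs
  · rwa [etaVal_one]
  · have h := ratCast_mem_subalgebra (A := A) (1 - 2 * (1 / 2) ^ s)
    push_cast at h
    rw [etaVal_of_two_le hs]
    exact A.mul_mem h (zetaVal_mem hpi hζ hs)

theorem betaVal_mem (hpi : Real.pi ∈ A) (hβ : ∀ k : ℕ, 1 ≤ k → betaVal (2 * k) ∈ A) {s : ℕ}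
    (hs : 1 ≤ s) : betaVal s ∈ A := by
  obtain ⟨k, rfl | rfl⟩ := Nat.even_or_odd' s
  · exact hβ k (by omega)
  · exact (isRatMulPiPow_betaVal k).mem hpi

end Adjoin

end MixedValues

/-! ### Assembly -/

theorem mainTheorem10 (ℓ : ℕ) (hℓ : 1 ≤ ℓ) :
    -- both nested series converge
    Tendsto (MixedValues.multSTrunc (MixedValues.barFirst (2 * ℓ)) (MixedValues.twoOnes (2 * ℓ)))
        atTop
        (𝓝 (MixedValues.multS (MixedValues.barFirst (2 * ℓ)) (MixedValues.twoOnes (2 * ℓ)))) ∧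
    Tendsto (MixedValues.altZetaTrunc ![-1, 1] ![2 * ℓ + 1, 1]) atTop
        (𝓝 (MixedValues.altZeta ![-1, 1] ![2 * ℓ + 1, 1])) ∧
    -- the explicit evaluation
    MixedValues.multS (MixedValues.barFirst (2 * ℓ)) (MixedValues.twoOnes (2 * ℓ)) =
      2 * MixedValues.altZeta ![-1, 1] ![2 * ℓ + 1, 1]
      + (2 : ℝ) ^ (-1 - 2 * (ℓ : ℤ)) * MixedValues.zetaVal (2 * ℓ + 2)
      + ((2 : ℝ) ^ (1 - 2 * (ℓ : ℤ)) - 4) * Real.log 2 * MixedValues.zetaVal (2 * ℓ + 1)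
      -- sum over r + 2k = 2ℓ - 1, with x = (r, k)
      + (∑ x ∈ Finset.range (2 * ℓ) ×ˢ Finset.range (2 * ℓ) with x.1 + 2 * x.2 + 1 = 2 * ℓ,
          4 * Real.log 2 * MixedValues.betaVal (x.1 + 1)
            * ((-1) ^ x.2 / ((2 * x.2 + 1).factorial : ℝ)) * (Real.pi / 2) ^ (2 * x.2 + 1))
      -- sum over p + q = 2ℓ + 2, p, q ≥ 2, with x = (p, q)
      + (∑ x ∈ Finset.HasAntidiagonal.antidiagonal (2 * ℓ + 2) with 2 ≤ x.1 ∧ 2 ≤ x.2,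
          (-1) ^ x.1 * (1 - (2 : ℝ) ^ (1 - (x.1 : ℤ))) * (3 - (2 : ℝ) ^ (1 - (x.2 : ℤ)))
            * MixedValues.zetaVal x.1 * MixedValues.zetaVal x.2)
      -- sum over r + 2k = 2ℓ, with x = (r, k)
      + (∑ x ∈ Finset.range (2 * ℓ + 1) ×ˢ Finset.range (2 * ℓ + 1) with x.1 + 2 * x.2 = 2 * ℓ,
          2 * MixedValues.betaVal (x.1 + 1)
            * ((-1) ^ (x.2 + 1) / ((2 * x.2 + 1).factorial : ℝ))
            * (Real.pi / 2) ^ (2 * x.2 + 1))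
      -- sum over p + r = 2ℓ, with x = (p, r)
      + (∑ x ∈ Finset.HasAntidiagonal.antidiagonal (2 * ℓ),
          2 * (-1) ^ x.1 * MixedValues.betaVal (x.2 + 1) * MixedValues.betaVal (x.1 + 1))
      -- sum over p + r + 2k = 2ℓ - 1, p ≥ 1, with x = (p, r, k)
      + (∑ x ∈ Finset.range (2 * ℓ) ×ˢ Finset.range (2 * ℓ) ×ˢ Finset.range (2 * ℓ) with
            1 ≤ x.1 ∧ x.1 + x.2.1 + 2 * x.2.2 + 1 = 2 * ℓ,
          4 * (-1) ^ (x.1 + x.2.2) * MixedValues.betaVal (x.2.1 + 1)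
            * (1 - (2 : ℝ) ^ (-(x.1 : ℤ))) * MixedValues.zetaVal (x.1 + 1)
            * (1 / ((2 * x.2.2 + 1).factorial : ℝ)) * (Real.pi / 2) ^ (2 * x.2.2 + 1)) ∧
    -- the conjectured shape: a rational polynomial in `log 2`, `π`, `ζ(odd)`, `β(even)`,
    -- plus a rational multiple of the double zeta value
    MixedValues.multS (MixedValues.barFirst (2 * ℓ)) (MixedValues.twoOnes (2 * ℓ))
        - 2 * MixedValues.altZeta ![-1, 1] ![2 * ℓ + 1, 1] ∈
      Algebra.adjoin ℚ (({Real.log 2, Real.pi} : Set ℝ)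
        ∪ {x | ∃ k : ℕ, 1 ≤ k ∧ x = MixedValues.zetaVal (2 * k + 1)}
        ∪ {x | ∃ p : ℕ, 1 ≤ p ∧ x = MixedValues.betaVal (2 * p)}) := by 
  have hlim := MixedValues.tendsto_multSTrunc hℓ
  have hval : MixedValues.multS (MixedValues.barFirst (2 * ℓ)) (MixedValues.twoOnes (2 * ℓ)) = _ :=
    hlim.limUnder_eq
  refine ⟨tendsto_nhds_limUnder ⟨_, hlim⟩, MixedValues.tendsto_altZetaTrunc (by omega), ?_, ?_⟩
  · have hA := MixedValues.sum_log_beta_add_sum_zeta_beta hℓ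
    have hB := MixedValues.sum_zeta_zeta hℓ
    have hC := MixedValues.sum_beta_pi ℓ
    have hD : (∑ x ∈ Finset.HasAntidiagonal.antidiagonal (2 * ℓ), 2 * (-1) ^ x.1 *
        MixedValues.betaVal (x.2 + 1) * MixedValues.betaVal (x.1 + 1)) =
        2 * ∑ x ∈ Finset.HasAntidiagonal.antidiagonal (2 * ℓ),
          (-1) ^ x.1 * MixedValues.betaVal (x.1 + 1) * MixedValues.betaVal (x.2 + 1) := by
      rw [Finset.mul_sum]
      exact Finset.sum_congr rfl fun x _ => by ring
    have hE : ∑ i ∈ Finset.range ℓ, MixedValues.etaVal (2 * (ℓ - i) - 1) *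
        (MixedValues.lamVal (2 * i + 3) - ∑ k ∈ Finset.range (i + 1),
          MixedValues.sinCoeff k * MixedValues.betaVal (2 * (i + 1 - k))) =
        ∑ j ∈ Finset.range ℓ, MixedValues.etaVal (2 * j + 1) *
          MixedValues.lamVal (2 * (ℓ - 1 - j) + 3) -
        ∑ j ∈ Finset.range ℓ, MixedValues.etaVal (2 * j + 1) *
          MixedValues.sinBetaCoeff (2 * (ℓ - 1 - j) + 1) := by
      -- Reversal i ↦ ℓ-1-i matches the order in which the moments were released with the eta index
      -- of the convolutions.
      rw [← Finset.sum_range_reflect, ← Finset.sum_sub_distrib]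
      refine Finset.sum_congr rfl fun j hj => ?_
      rw [Finset.mem_range] at hj
      rw [← MixedValues.sinBetaCoeff_odd, show 2 * (ℓ - (ℓ - 1 - j)) - 1 = 2 * j + 1 by omega,
        mul_sub]
    have hz1 : (2 : ℝ) ^ (-1 - 2 * (ℓ : ℤ)) = (1 / 2) ^ (2 * ℓ + 1) := by
      rw [← MixedValues.two_zpow_neg_natCast]
      congr 1
      push_cast
      ring
    have hz2 : (2 : ℝ) ^ (1 - 2 * (ℓ : ℤ)) = 2 * (1 / 2) ^ (2 * ℓ) := by
      rw [← MixedValues.two_zpow_one_sub_natCast]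
      push_cast
      rfl
    have hη : MixedValues.etaVal (2 * ℓ + 1) = _ := MixedValues.etaVal_of_two_le (by omega)
    have hη' : MixedValues.etaVal (2 * ℓ + 2) = _ := MixedValues.etaVal_of_two_le (by omega)
    rw [hE] at hval
    rw [hval, hB, hC, hD, hz1, hz2]
    simp only [MixedValues.lamVal, hη, hη', pow_succ (1 / 2 : ℝ)] at hA ⊢
    linear_combination -hA
  · rw [hval]
    set A := Algebra.adjoin ℚ (({Real.log 2, Real.pi} : Set ℝ)
        ∪ {x | ∃ k : ℕ, 1 ≤ k ∧ x = MixedValues.zetaVal (2 * k + 1)}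
        ∪ {x | ∃ p : ℕ, 1 ≤ p ∧ x = MixedValues.betaVal (2 * p)})
    have hlog : Real.log 2 ∈ A := Algebra.subset_adjoin (by simp)
    have hpi : Real.pi ∈ A := Algebra.subset_adjoin (by simp)
    have hζ : ∀ k : ℕ, 1 ≤ k → MixedValues.zetaVal (2 * k + 1) ∈ A := fun k hk =>
      Algebra.subset_adjoin (Or.inl (Or.inr ⟨k, hk, rfl⟩))
    have hβ : ∀ k : ℕ, 1 ≤ k → MixedValues.betaVal (2 * k) ∈ A := fun k hk =>
      Algebra.subset_adjoin (Or.inr ⟨k, hk, rfl⟩)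
    have hη : ∀ {s : ℕ}, 1 ≤ s → MixedValues.etaVal s ∈ A := MixedValues.etaVal_mem hlog hpi hζ
    have hbeta : ∀ {s : ℕ}, 1 ≤ s → MixedValues.betaVal s ∈ A := MixedValues.betaVal_mem hpi hβ
    have hsign : ∀ n : ℕ, (-1 : ℝ) ^ n ∈ A := fun n => A.pow_mem (A.neg_mem A.one_mem) n
    have h2 : (2 : ℝ) ∈ A := by exact_mod_cast A.natCast_mem 2
    have h4 : (4 : ℝ) ∈ A := by exact_mod_cast A.natCast_mem 4
    -- The double zeta value cancels; membership is checked on the unexpanded limit, whose remaining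
    -- terms are products of η, λ, β and ζ values, log 2 and sine coefficients.
    have hrw : ∀ z a b c d e f : ℝ, z + a + b - c + d - e - f - z = a + b - c + d - e - f :=
      fun z a b c d e f => by ring
    rw [hrw]
    refine A.sub_mem (A.sub_mem (A.add_mem (A.sub_mem (A.add_mem ?_ ?_) ?_) ?_) ?_) ?_
    · exact A.sum_mem fun x _ => A.mul_mem (A.mul_mem (hsign _) (hη (by omega))) (hη (by omega))
    · exact A.mul_mem (A.mul_mem h2 hlog) (hζ ℓ hℓ)
    · exact A.mul_mem h2 (hη (by omega))
    · exact A.mul_mem h2 (A.sum_mem fun x _ =>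
        A.mul_mem (A.mul_mem (hsign _) (hbeta (by omega))) (hbeta (by omega)))
    · exact A.mul_mem (A.mul_mem h4 hlog) (MixedValues.lamVal_mem hpi hζ (by omega))
    · refine A.mul_mem h4 (A.sum_mem fun i hi => ?_)
      rw [Finset.mem_range] at hi
      refine A.mul_mem (hη (by omega)) (A.sub_mem (MixedValues.lamVal_mem hpi hζ (by omega))
        (A.sum_mem fun k hk => ?_))
      rw [Finset.mem_range] at hk
      exact A.mul_mem ((MixedValues.isRatMulPiPow_sinCoeff k).mem hpi) (hbeta (by omega))
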